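/- Let $m\ge 1$, $n\ge 0$ and let $m\mathcal{TL}_n$ be the $m$-cyclic Temperley--Lieb monoid: its elements are pairs $(a,i)$ of a crossingless perfect matching $a$ of $n$ top and $n$ bottom points of a strip and $i\in\mathbb Z/m\mathbb Z$, with product $(a,i)(b,j)=(ab,\,i+j+\Phi(a,b))$, where $ab$ is obtained by stacking $a$ on top of $b$ and $\Phi(a,b)$ is the number of closed components that arise. Let $0\le k<l\le n$ with $k\equiv l\equiv n \pmod 2$ and $l\ge 3$, and assume that $(n,k,l)$ is neither $(3,1,3)$ nor $(4,0,4)$. Let $\mathcal S=m\mathcal{TL}_n^{k\le l}$ be the truncated monoid, that is, the submonoid of $m\mathcal{TL}_n$ consisting of the identity and all diagrams with at most $l$ through strands, in which, if $k\ge 2$, all diagrams with fewer than $k$ through strands are identified to one zero element (if $k\le 1$ there are no such diagrams, and no zero is added). Let $\mathcal G$ be the group of units of $\mathcal S$, and let $\mathbb K$ be a field with $\operatorname{char}\mathbb K\nmid m$. Then: 1. $\mathcal S$ is well-connected: $\mathcal S\setminus\mathcal G$ is non-empty; every element of $\mathcal S\setminus\mathcal G$ is a product of two elements of $\mathcal S\setminus\mathcal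 G$ (null-connected); $\mathcal S\setminus\mathcal G$ is a single class of the equivalence relation generated by $ba\approx_l a$ for $a,b\in\mathcal S\setminus\mathcal G$ (left-connected), and a single class of the one generated by $ab\approx_r a$ for $a,b\in\mathcal S\setminus\mathcal G$ (right-connected). 2. The only monoid homomorphism $\mathcal S\to(\mathbb K,+)$ is $0$. 3. Let $\mathbb 1_t$ be the one-dimensional representation $s\mapsto 1$ of $\mathcal S$ and $\mathbb 1_b$ the one with $s\mapsto 1$ for $s\in\mathcal G$ and $s\mapsto 0$ otherwise; call $(\mathcal S,\mathbb K)$ $r$-trivial if every representation of $\mathcal S$ over $\mathbb K$ of dimension at most $r$ is isomorphic to a direct sum of copies of $\mathbb 1_b$ and $\mathbb 1_t$, except that, by convention, the trivial monoid and the monoid $\{1,a\}$ with $a^2=a\neq 1$ are only $(-1)$-trivial. Then $\mathcal S$ has a simple representation not isomorphic to $\mathbb 1_b$ or $\mathbb 1_t$, and the representation gap $\operatorname{gap}_{\mathbb K}(\mathcal S)=\max\{r\mid(\mathcal S,\mathbb K)\text{ is }(r-1)\text{-trivial}\}$ exists and equals \[\min\{\dim_{\mathbb K}L\mid L\text{ a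 simple representation of }\mathcal S,\ L\not\cong\mathbb 1_b,\ L\not\cong\mathbb 1_t\}.\] -/

import Mathlib

universe u

/-! ### Diagrams with `n` top and `n` bottom points, stacking, internal components -/

/-- The boundary points of a diagram on `n` strands: `inl i` is the `i`-th top point and
`inr i` is the `i`-th bottom point, both counted from the left. -/
abbrev BPoint (n : ℕ) : Type := Fin n ⊕ Fin n

/-- The points that occur when two diagrams on `n` strands are stacked: the top points, the
middle points (along which the diagrams are glued) and the bottom points. -/
abbrev GPoint (n : ℕ) : Type := Fin n ⊕ (Fin n ⊕ Fin n)

/-- The boundary points of the upper diagram of a stack. -/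
def upperPt {n : ℕ} : BPoint n → GPoint n := Sum.elim Sum.inl (fun i => Sum.inr (Sum.inl i))

/-- The boundary points of the lower diagram of a stack. -/
def lowerPt {n : ℕ} : BPoint n → GPoint n :=
  Sum.elim (fun i => Sum.inr (Sum.inl i)) (fun i => Sum.inr (Sum.inr i))

/-- The boundary points of the stack itself. -/
def outerPt {n : ℕ} : BPoint n → GPoint n := Sum.elim Sum.inl (fun i => Sum.inr (Sum.inr i))

/-- The graph obtained by stacking `a` on top of `b`; the blocks of a set partition are the
sets of points that the diagram connects. -/
def glueGraph {n : ℕ} (a b : Setoid (BPoint n)) : SimpleGraph (GPoint n) :=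
  SimpleGraph.fromRel fun x y =>
    (∃ p q, a p q ∧ upperPt p = x ∧ upperPt q = y) ∨ (∃ p q, b p q ∧ lowerPt p = x ∧ lowerPt q = y)

/-- The skeleton of the stack of `a` on top of `b`. -/
def stack {n : ℕ} (a b : Setoid (BPoint n)) : Setoid (BPoint n) :=
  Setoid.comap outerPt (glueGraph a b).reachableSetoid

/-- The number of internal components that arise when `a` is stacked on top of `b`: the
connected components of the stack that contain no boundary point of the stack. -/
noncomputable def stackLoops {n : ℕ} (a b : Setoid (BPoint n)) : ℕ :=
  Nat.card {c : (glueGraph a b).ConnectedComponent //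
    ∀ p : BPoint n, (glueGraph a b).connectedComponentMk (outerPt p) ≠ c}

/-- The identity diagram: the `i`-th top point is connected to the `i`-th bottom point. -/
def idDiagram (n : ℕ) : Setoid (BPoint n) := Setoid.ker (Sum.elim id id : BPoint n → Fin n)

section DiagramFacts

variable {n : ℕ}

theorem glue_upper {a b : Setoid (BPoint n)} {p q : BPoint n} (h : a p q) :
    (glueGraph a b).Reachable (upperPt p) (upperPt q) := by
  by_cases e : upperPt p = upperPt q
  · rw [e]
  · exact SimpleGraph.Adj.reachable
      ((SimpleGraph.fromRel_adj _ _ _).2 ⟨e, Or.inl (Or.inl ⟨p, q, h, rfl, rfl⟩)⟩)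

theorem glue_lower {a b : Setoid (BPoint n)} {p q : BPoint n} (h : b p q) :
    (glueGraph a b).Reachable (lowerPt p) (lowerPt q) := by
  by_cases e : lowerPt p = lowerPt q
  · rw [e]
  · exact SimpleGraph.Adj.reachable
      ((SimpleGraph.fromRel_adj _ _ _).2 ⟨e, Or.inl (Or.inr ⟨p, q, h, rfl, rfl⟩)⟩)

/-- A reflexive, symmetric and transitive relation that holds along the strands of both diagrams
holds along the components of the stack. -/
theorem glue_induction {a b : Setoid (BPoint n)} {S : GPoint n → GPoint n → Prop}
    (hS : Equivalence S) (ha : ∀ p q, a p q → S (upperPt p) (upperPt q))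
    (hb : ∀ p q, b p q → S (lowerPt p) (lowerPt q)) {x y : GPoint n}
    (h : (glueGraph a b).Reachable x y) : S x y := by
  obtain ⟨w⟩ := h
  induction w with
  | nil => exact hS.refl _
  | cons hadj _ ih =>
    refine hS.trans ?_ ih
    obtain ⟨-, h | h⟩ := (SimpleGraph.fromRel_adj _ _ _).1 hadj
    · rcases h with ⟨p, q, h, rfl, rfl⟩ | ⟨p, q, h, rfl, rfl⟩
      · exact ha _ _ h
      · exact hb _ _ h
    · rcases h with ⟨p, q, h, rfl, rfl⟩ | ⟨p, q, h, rfl, rfl⟩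
      · exact hS.symm (ha _ _ h)
      · exact hS.symm (hb _ _ h)

/-- A two-colouring `f` of the top points and `g` of the bottom points is constant on the blocks
of `a`. -/
def Colours (a : Setoid (BPoint n)) (f g : Fin n → Bool) : Prop :=
  ∀ p q, a p q → (Sum.elim f g p : Bool) = Sum.elim f g q

open Classical in
/-- The matrix of admissible two-colourings of a diagram; only used to prove associativity. -/
noncomputable def colourMatrix (a : Setoid (BPoint n)) :
    Matrix (Fin n → Bool) (Fin n → Bool) ℕ :=
  Matrix.of fun f g => if Colours a f g then 1 else 0

theorem colours_glue {a b : Setoid (BPoint n)} {f h g : Fin n → Bool}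
    (ha : Colours a f h) (hb : Colours b h g) {x y : GPoint n}
    (hxy : (glueGraph a b).Reachable x y) :
    (Sum.elim f (Sum.elim h g) x : Bool) = Sum.elim f (Sum.elim h g) y := by
  refine glue_induction (S := fun x y => (Sum.elim f (Sum.elim h g) x : Bool) =
    Sum.elim f (Sum.elim h g) y) ⟨fun _ => rfl, fun h => h.symm, fun h k => h.trans k⟩ ?_ ?_ hxy
  · intro p q hpq
    have := ha p q hpq
    rcases p with p | p <;> rcases q with q | q <;> simpa [upperPt] using this
  · intro p q hpq
    have := hb p q hpq
    rcases p with p | p <;> rcases q with q | q <;> simpa [lowerPt] using this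

theorem elim_outer (f h g : Fin n → Bool) (p : BPoint n) :
    (Sum.elim f (Sum.elim h g) (outerPt p) : Bool) = Sum.elim f g p := by
  rcases p with p | p <;> rfl

theorem colour_count (a b : Setoid (BPoint n)) (f g : Fin n → Bool) (hc : Colours (stack a b) f g) :
    Nat.card {h : Fin n → Bool // Colours a f h ∧ Colours b h g} = 2 ^ stackLoops a b := by
  classical
  set G := glueGraph a b
  let F : {h : Fin n → Bool // Colours a f h ∧ Colours b h g} →
      ({c : G.ConnectedComponent // ∀ p : BPoint n, G.connectedComponentMk (outerPt p) ≠ c} →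
        Bool) := fun h c => Sum.elim f (Sum.elim h.1 g) (Quot.out c.1)
  have hout : ∀ x : GPoint n, G.Reachable (Quot.out (G.connectedComponentMk x)) x := fun x =>
    SimpleGraph.ConnectedComponent.exact (Quot.out_eq (G.connectedComponentMk x))
  have hF : Function.Bijective F := by
    constructor
    · rintro ⟨h, h1, h2⟩ ⟨k, k1, k2⟩ hhk
      apply Subtype.ext
      funext i
      by_cases hi : ∃ p, G.connectedComponentMk (outerPt p) =
          G.connectedComponentMk (Sum.inr (Sum.inl i))
      · obtain ⟨p, hp⟩ := hi
        have hp := SimpleGraph.ConnectedComponent.exact hp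
        have e1 := colours_glue h1 h2 hp
        have e2 := colours_glue k1 k2 hp
        rw [elim_outer] at e1 e2
        exact e1.symm.trans e2
      · push Not at hi
        have e := congrFun hhk ⟨_, hi⟩
        have e1 := colours_glue h1 h2 (hout (Sum.inr (Sum.inl i)))
        have e2 := colours_glue k1 k2 (hout (Sum.inr (Sum.inl i)))
        exact e1.symm.trans (e.trans e2)
    · intro ψ
      let κ : G.ConnectedComponent → Bool := fun c =>
        if hc : ∃ p, G.connectedComponentMk (outerPt p) = c then Sum.elim f g hc.choose
        else ψ ⟨c, fun p hp => hc ⟨p, hp⟩⟩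
      have hκ : ∀ p, κ (G.connectedComponentMk (outerPt p)) = Sum.elim f g p := by
        intro p
        have hex : ∃ q, G.connectedComponentMk (outerPt q) = G.connectedComponentMk (outerPt p) :=
          ⟨p, rfl⟩
        simp only [κ, dif_pos hex]
        exact hc _ _ (SimpleGraph.ConnectedComponent.exact hex.choose_spec)
      let h : Fin n → Bool := fun i => κ (G.connectedComponentMk (Sum.inr (Sum.inl i)))
      have key : ∀ x, (Sum.elim f (Sum.elim h g) x : Bool) = κ (G.connectedComponentMk x) := by
        rintro (i | i | i)
        · exact (hκ (Sum.inl i)).symm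
        · rfl
        · exact (hκ (Sum.inr i)).symm
      have hu : ∀ p, (Sum.elim f h p : Bool) = κ (G.connectedComponentMk (upperPt p)) := by
        intro p
        rw [← key]
        rcases p with p | p <;> rfl
      have hl : ∀ p, (Sum.elim h g p : Bool) = κ (G.connectedComponentMk (lowerPt p)) := by
        intro p
        rw [← key]
        rcases p with p | p <;> rfl
      refine ⟨⟨h, ?_, ?_⟩, ?_⟩
      · intro p q hpq
        rw [hu, hu, SimpleGraph.ConnectedComponent.sound (glue_upper hpq)]
      · intro p q hpq
        rw [hl, hl, SimpleGraph.ConnectedComponent.sound (glue_lower hpq)]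
      · funext c
        change (Sum.elim f (Sum.elim h g) (Quot.out c.1) : Bool) = ψ c
        rw [key]
        have hq : G.connectedComponentMk (Quot.out c.1) = c.1 := Quot.out_eq c.1
        rw [hq]
        have hne : ¬ ∃ p, G.connectedComponentMk (outerPt p) = c.1 := fun ⟨p, hp⟩ => c.2 p hp
        simp only [κ, dif_neg hne]
  rw [Nat.card_congr (Equiv.ofBijective F hF), Nat.card_fun]
  simp [stackLoops, G]

theorem colourMatrix_mul (a b : Setoid (BPoint n)) :
    colourMatrix a * colourMatrix b = 2 ^ stackLoops a b • colourMatrix (stack a b) := by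
  classical
  ext f g
  have h1 : (colourMatrix a * colourMatrix b) f g =
      Nat.card {h : Fin n → Bool // Colours a f h ∧ Colours b h g} := by
    rw [Matrix.mul_apply, Nat.card_eq_fintype_card, Fintype.card_subtype,
      Finset.card_eq_sum_ones, Finset.sum_filter]
    refine Finset.sum_congr rfl fun h _ => ?_
    by_cases h1 : Colours a f h <;> by_cases h2 : Colours b h g <;> simp [colourMatrix, h1, h2]
  rw [h1]
  by_cases hc : Colours (stack a b) f g
  · rw [colour_count a b f g hc]
    simp [colourMatrix, hc]
  · have : IsEmpty {h : Fin n → Bool // Colours a f h ∧ Colours b h g} := by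
      refine ⟨fun ⟨h, h1, h2⟩ => hc fun p q hpq => ?_⟩
      have := colours_glue h1 h2 hpq
      rwa [elim_outer, elim_outer] at this
    simp [colourMatrix, hc]

theorem colourMatrix_const (a : Setoid (BPoint n)) :
    colourMatrix a (fun _ => true) (fun _ => true) = 1 := by
  have : Colours a (fun _ => true) (fun _ => true) := by
    rintro (p | p) (q | q) _ <;> rfl
  simp [colourMatrix, this]

theorem colourMatrix_inj {a b : Setoid (BPoint n)} (h : colourMatrix a = colourMatrix b) :
    a = b := by
  classical
  have key : ∀ f g, Colours a f g ↔ Colours b f g := by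
    intro f g
    have := congrFun (congrFun h f) g
    simp only [colourMatrix, Matrix.of_apply] at this
    by_cases h1 : Colours a f g <;> by_cases h2 : Colours b f g <;> simp [h1, h2] at this ⊢
  have main : ∀ c d : Setoid (BPoint n), (∀ f g, Colours c f g → Colours d f g) →
      ∀ p q, d p q → c p q := by
    intro c d hcd p q hpq
    have e : ∀ r : BPoint n, (Sum.elim (fun i => decide (c p (Sum.inl i)))
        (fun i => decide (c p (Sum.inr i))) r : Bool) = decide (c p r) := by
      rintro (r | r) <;> rfl
    have hc : Colours c (fun i => decide (c p (Sum.inl i))) (fun i => decide (c p (Sum.inr i))) := by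
      intro r s hrs
      rw [e, e, decide_eq_decide]
      exact ⟨fun h => c.trans' h hrs, fun h => c.trans' h (c.symm' hrs)⟩
    have := hcd _ _ hc p q hpq
    rw [e, e, decide_eq_decide] at this
    exact this.1 (c.refl' p)
  ext p q
  exact ⟨main b a (fun f g => (key f g).2) p q, main a b (fun f g => (key f g).1) p q⟩

theorem colourMatrix_id : colourMatrix (idDiagram n) = 1 := by
  classical
  ext f g
  have : Colours (idDiagram n) f g ↔ f = g := by
    constructor
    · intro h
      funext i
      exact h (Sum.inl i) (Sum.inr i) rfl
    · rintro rfl p q hpq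
      have hpq : (Sum.elim id id p : Fin n) = Sum.elim id id q := hpq
      rcases p with p | p <;> rcases q with q | q <;> simp_all
  simp [colourMatrix, this, Matrix.one_apply]

theorem colourMatrix_smul_inj {a b : Setoid (BPoint n)} {i j : ℕ}
    (h : 2 ^ i • colourMatrix a = 2 ^ j • colourMatrix b) : i = j ∧ a = b := by
  have h1 := congrFun (congrFun h (fun _ => true)) (fun _ => true)
  simp only [Matrix.smul_apply, colourMatrix_const, smul_eq_mul, mul_one] at h1
  have hij : i = j := Nat.pow_right_injective le_rfl h1
  subst hij
  refine ⟨rfl, colourMatrix_inj ?_⟩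
  ext f g
  have h2 := congrFun (congrFun h f) g
  simp only [Matrix.smul_apply, smul_eq_mul] at h2
  exact Nat.eq_of_mul_eq_mul_left (by positivity) h2

theorem stack_assoc (a b c : Setoid (BPoint n)) :
    stackLoops a b + stackLoops (stack a b) c = stackLoops b c + stackLoops a (stack b c) ∧
      stack (stack a b) c = stack a (stack b c) := by
  apply colourMatrix_smul_inj
  have h := Matrix.mul_assoc (colourMatrix a) (colourMatrix b) (colourMatrix c)
  rw [colourMatrix_mul, colourMatrix_mul, Matrix.smul_mul, Matrix.mul_smul, colourMatrix_mul,
    colourMatrix_mul, smul_smul, smul_smul, ← pow_add, ← pow_add] at h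
  exact h

theorem id_stack (a : Setoid (BPoint n)) :
    stackLoops (idDiagram n) a = 0 ∧ stack (idDiagram n) a = a := by
  apply colourMatrix_smul_inj
  rw [← colourMatrix_mul, colourMatrix_id, Matrix.one_mul, pow_zero, one_smul]

theorem stack_id (a : Setoid (BPoint n)) :
    stackLoops a (idDiagram n) = 0 ∧ stack a (idDiagram n) = a := by
  apply colourMatrix_smul_inj
  rw [← colourMatrix_mul, colourMatrix_id, Matrix.mul_one, pow_zero, one_smul]

end DiagramFacts

/-- A diagram on `n` strands together with its number of internal components, counted
modulo `m`. -/
@[ext]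
structure LoopDiagram (m n : ℕ) : Type where
  /-- The skeleton: which boundary points are connected. -/
  skel : Setoid (BPoint n)
  /-- The number of internal components modulo `m`. -/
  loops : ZMod m

/-- Multiplication is vertical stacking, `(a, i) (b, j) = (ab, i + j + Φ(a, b))`. -/
noncomputable instance (m n : ℕ) : Monoid (LoopDiagram m n) where
  mul x y := ⟨stack x.skel y.skel, x.loops + y.loops + (stackLoops x.skel y.skel : ZMod m)⟩
  one := ⟨idDiagram n, 0⟩
  mul_assoc x y z := by
    have h := stack_assoc x.skel y.skel z.skel
    refine LoopDiagram.ext h.2 ?_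
    have h1 := congrArg (Nat.cast : ℕ → ZMod m) h.1
    push_cast at h1
    change x.loops + y.loops + (stackLoops x.skel y.skel : ZMod m) + z.loops +
        (stackLoops (stack x.skel y.skel) z.skel : ZMod m) =
      x.loops + (y.loops + z.loops + (stackLoops y.skel z.skel : ZMod m)) +
        (stackLoops x.skel (stack y.skel z.skel) : ZMod m)
    linear_combination h1
  one_mul x := by
    refine LoopDiagram.ext (id_stack x.skel).2 ?_
    change 0 + x.loops + (stackLoops (idDiagram n) x.skel : ZMod m) = x.loops
    rw [(id_stack x.skel).1]
    simp
  mul_one x := by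
    refine LoopDiagram.ext (stack_id x.skel).2 ?_
    change x.loops + 0 + (stackLoops x.skel (idDiagram n) : ZMod m) = x.loops
    rw [(stack_id x.skel).1]
    simp

/-! ### Crossingless matchings -/

/-- Every boundary point is connected to exactly one other boundary point. -/
def IsMatching {n : ℕ} (a : Setoid (BPoint n)) : Prop := ∀ p, ∃! q, q ≠ p ∧ a p q

/-- The position of a boundary point when one walks around the boundary of the strip: the top
points from left to right, then the bottom points from right to left. -/
def bpos {n : ℕ} : BPoint n → ℕ := Sum.elim (fun i => (i : ℕ)) (fun i => 2 * n - 1 - (i : ℕ))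

/-- No two strands cross: the end points of two strands never alternate along the boundary. -/
def IsCrossingless {n : ℕ} (a : Setoid (BPoint n)) : Prop :=
  ∀ p q r s, bpos p < bpos q → bpos q < bpos r → bpos r < bpos s → ¬ (a p r ∧ a q s)

section MatchingFacts

variable {n : ℕ}

theorem bpos_inj {p q : BPoint n} (h : bpos p = bpos q) : p = q := by
  rcases p with p | p <;> rcases q with q | q <;> simp only [bpos, Sum.elim_inl, Sum.elim_inr] at h <;>
    first
      | (congr 1; ext; omega)
      | (exfalso; omega)

theorem IsMatching.exists_partner {a : Setoid (BPoint n)} (ha : IsMatching a) :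
    ∃ σ : BPoint n → BPoint n, (∀ p, σ p ≠ p) ∧ (∀ p, a p (σ p)) ∧ (∀ p, σ (σ p) = p) ∧
      ∀ p q, a p q → q = p ∨ q = σ p := by
  choose σ hσ hu using ha
  refine ⟨σ, fun p => (hσ p).1, fun p => (hσ p).2, fun p => ?_, fun p q h => ?_⟩
  · exact (hu (σ p) p ⟨(hσ p).1.symm, a.symm' (hσ p).2⟩).symm
  · by_cases e : q = p
    · exact Or.inl e
    · exact Or.inr (hu p q ⟨e, h⟩)

theorem IsMatching.sum_eq_zero {a : Setoid (BPoint n)} (ha : IsMatching a) (f : BPoint n → ZMod 2)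
    (hf : ∀ p q, a p q → f p = f q) : ∑ p, f p = 0 := by
  obtain ⟨σ, h1, h2, h3, -⟩ := ha.exists_partner
  refine Finset.sum_ninvolution σ (fun p => ?_) (fun p _ => h1 p) (fun p => Finset.mem_univ _) h3
  rw [← hf p (σ p) (h2 p)]
  exact CharTwo.add_self_eq_zero _

/-- The sum of `χ` over the boundary points before `x`. -/
def posSum (χ : BPoint n → ZMod 2) (x : BPoint n) : ZMod 2 :=
  ∑ z, if bpos z < bpos x then χ z else 0

theorem posSum_inl (χ : BPoint n → ZMod 2) (i : Fin n) :
    posSum χ (Sum.inl i) = ∑ j, if j < i then χ (Sum.inl j) else 0 := by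
  rw [posSum, Fintype.sum_sum_type]
  have : ∀ j : Fin n, ¬ (2 * n - 1 - (j : ℕ) < (i : ℕ)) := fun j => by omega
  simp [bpos, this]

theorem posSum_inr (χ : BPoint n → ZMod 2) (i : Fin n) :
    posSum χ (Sum.inr i) = (∑ j, χ (Sum.inl j)) + ∑ j, if i < j then χ (Sum.inr j) else 0 := by
  rw [posSum, Fintype.sum_sum_type]
  have h1 : ∀ j : Fin n, (j : ℕ) < 2 * n - 1 - (i : ℕ) := fun j => by omega
  have h2 : ∀ j : Fin n, (2 * n - 1 - (j : ℕ) < 2 * n - 1 - (i : ℕ)) ↔ i < j := fun j => by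
    rw [Fin.lt_def]; omega
  simp [bpos, h1, h2]

theorem posSum_pair {χ : BPoint n → ZMod 2} {p r : BPoint n} (hne : p ≠ r)
    (hval : ∀ z, χ z = (if z = p then 1 else 0) + (if z = r then 1 else 0)) (x : BPoint n) :
    posSum χ x = (if bpos p < bpos x then 1 else 0) + (if bpos r < bpos x then 1 else 0) := by
  have : ∀ z, (if bpos z < bpos x then χ z else 0) =
      (if z = p then (if bpos p < bpos x then (1 : ZMod 2) else 0) else 0) +
        (if z = r then (if bpos r < bpos x then (1 : ZMod 2) else 0) else 0) := by
    intro z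
    rw [hval]
    by_cases hzp : z = p
    · rw [hzp, if_pos rfl, if_neg hne, if_pos rfl, if_neg hne, add_zero, add_zero]
    · by_cases hzr : z = r
      · rw [hzr, if_pos rfl, if_neg hne.symm, if_pos rfl, if_neg hne.symm, zero_add, zero_add]
      · rw [if_neg hzp, if_neg hzr, if_neg hzp, if_neg hzr, add_zero, ite_self]
  rw [posSum, Finset.sum_congr rfl fun z _ => this z, Finset.sum_add_distrib]
  simp

theorem posSum_eq {a : Setoid (BPoint n)} (ha : IsMatching a) (hc : IsCrossingless a)
    (χ : BPoint n → ZMod 2) (hχ : ∀ p q, a p q → χ p = χ q) {x y : BPoint n} (hxy : a x y)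
    (hx : χ x = 0) : posSum χ x = posSum χ y := by
  wlog hlt : bpos x < bpos y generalizing x y
  · rcases (not_lt.1 hlt).lt_or_eq with h | h
    · exact (this (a.symm' hxy) ((hχ x y hxy).symm.trans hx) h).symm
    · rw [bpos_inj h]
  obtain ⟨σ, h1, h2, h3, h4⟩ := ha.exists_partner
  have hinv : ∀ z w, a z w → bpos x < bpos z → bpos z < bpos y → bpos x < bpos w ∧ bpos w < bpos y := by
    intro z w hzw hz1 hz2
    have hzx : ¬ a x z := by
      intro h
      rcases h4 x z h with e | e
      · rw [e] at hz1; exact lt_irrefl _ hz1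
      · rcases h4 x y hxy with e' | e'
        · rw [e'] at hlt; exact lt_irrefl _ hlt
        · rw [e, ← e'] at hz2; exact lt_irrefl _ hz2
    constructor
    · by_contra hcon
      rcases (not_lt.1 hcon).lt_or_eq with h | h
      · exact hc w x z y h hz1 hz2 ⟨a.symm' hzw, hxy⟩
      · rw [bpos_inj h] at hzw; exact hzx (a.symm' hzw)
    · by_contra hcon
      rcases (not_lt.1 hcon).lt_or_eq with h | h
      · exact hc x z y w hz1 hz2 h ⟨hxy, hzw⟩
      · rw [← bpos_inj h] at hzw; exact hzx (a.trans' hxy (a.symm' hzw))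
  have hzero := ha.sum_eq_zero (fun z => if bpos x < bpos z ∧ bpos z < bpos y then χ z else 0) (by
    intro p q hpq
    have : (bpos x < bpos p ∧ bpos p < bpos y) ↔ (bpos x < bpos q ∧ bpos q < bpos y) :=
      ⟨fun h => hinv p q hpq h.1 h.2, fun h => hinv q p (a.symm' hpq) h.1 h.2⟩
    simp only [this, hχ p q hpq])
  have hsum : posSum χ y = posSum χ x +
      ∑ z, (if bpos x < bpos z ∧ bpos z < bpos y then χ z else 0) := by
    rw [posSum, posSum, ← Finset.sum_add_distrib]
    refine Finset.sum_congr rfl fun z _ => ?_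
    rcases lt_trichotomy (bpos z) (bpos x) with h | h | h
    · rw [if_pos (h.trans hlt), if_pos h, if_neg (fun h' => absurd h'.1 (not_lt.2 h.le)), add_zero]
    · rw [bpos_inj h]; simp [hx]
    · simp [h, not_lt.2 h.le]
  rw [hsum, hzero, add_zero]

open Classical in
theorem stack_class_card_le {a b : Setoid (BPoint n)} (ha : IsMatching a) (hb : IsMatching b)
    (p : BPoint n) :
    (Finset.univ.filter fun q => (glueGraph a b).Reachable (outerPt p) (outerPt q)).card ≤ 2 := by
  obtain ⟨σ, -, -, -, hσ⟩ := ha.exists_partner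
  obtain ⟨τ, -, -, -, hτ⟩ := hb.exists_partner
  obtain ⟨G, hG⟩ : ∃ G, G = glueGraph a b := ⟨_, rfl⟩
  rw [← hG]
  let C := G.connectedComponentMk (outerPt p)
  let N : GPoint n → Finset (GPoint n) := Sum.elim (fun i => {upperPt (σ (Sum.inl i))})
    (Sum.elim (fun i => {upperPt (σ (Sum.inr i)), lowerPt (τ (Sum.inl i))})
      (fun i => {lowerPt (τ (Sum.inr i))}))
  let w : GPoint n → ℕ := Sum.elim (fun _ => 1) (Sum.elim (fun _ => 2) (fun _ => 1))
  have hNw : ∀ x, (N x).card ≤ w x := by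
    rintro (i | i | i)
    · simp [N, w]
    · exact Finset.card_le_two
    · simp [N, w]
  have hup : ∀ q r, a q r → upperPt q ≠ upperPt r → upperPt r ∈ N (upperPt q) := by
    intro q r hqr hne
    rcases hσ q r hqr with rfl | rfl
    · exact absurd rfl hne
    · rcases q with q | q <;> simp [N, upperPt]
  have hlo : ∀ q r, b q r → lowerPt q ≠ lowerPt r → lowerPt r ∈ N (lowerPt q) := by
    intro q r hqr hne
    rcases hτ q r hqr with rfl | rfl
    · exact absurd rfl hne
    · rcases q with q | q <;> simp [N, lowerPt]
  have hadj : ∀ x y, G.Adj x y → y ∈ N x := by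
    intro x y hxy
    rw [hG] at hxy
    obtain ⟨hne, h | h⟩ := (SimpleGraph.fromRel_adj _ _ _).1 hxy
    · rcases h with ⟨q, r, h, rfl, rfl⟩ | ⟨q, r, h, rfl, rfl⟩
      · exact hup _ _ h hne
      · exact hlo _ _ h hne
    · rcases h with ⟨q, r, h, rfl, rfl⟩ | ⟨q, r, h, rfl, rfl⟩
      · exact hup _ _ (a.symm' h) hne
      · exact hlo _ _ (b.symm' h) hne
  have hdeg : ∀ v : C, C.toSimpleGraph.degree v ≤ w v.1 := by
    intro v
    refine le_trans ?_ (hNw v.1)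
    rw [← SimpleGraph.card_neighborFinset_eq_degree]
    refine Finset.card_le_card_of_injOn Subtype.val ?_ Subtype.val_injective.injOn
    intro u hu
    have hu : C.toSimpleGraph.Adj v u := by simpa using hu
    exact hadj v.1 u.1 hu
  have hvert := C.connected_toSimpleGraph.card_vert_le_card_edgeSet_add_one
  rw [Nat.card_eq_fintype_card, Nat.card_eq_fintype_card, ← SimpleGraph.edgeFinset_card] at hvert
  have hsum := C.toSimpleGraph.sum_degrees_eq_twice_card_edges
  have hle : ∑ v : C, C.toSimpleGraph.degree v ≤ ∑ v : C, w v.1 :=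
    Finset.sum_le_sum fun v _ => hdeg v
  have hmem : ∀ x, x ∈ C ↔ G.Reachable (outerPt p) x := fun x => by
    exact ⟨fun h => (SimpleGraph.ConnectedComponent.exact h).symm,
      fun h => SimpleGraph.ConnectedComponent.sound h.symm⟩
  have hconv : ∀ u : GPoint n → ℕ, ∑ v : C, u v.1 =
      ∑ x, if G.Reachable (outerPt p) x then u x else 0 := by
    intro u
    rw [← Finset.sum_filter]
    exact (Finset.sum_subtype (p := fun x => x ∈ C) _ (fun x => by simp [hmem]) u).symm
  have hcard : Fintype.card C = ∑ x, if G.Reachable (outerPt p) x then 1 else 0 := by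
    rw [← hconv fun _ => 1]; simp
  rw [hconv] at hle
  rw [Finset.card_filter, Fintype.sum_sum_type]
  simp only [Fintype.sum_sum_type, w, Sum.elim_inl, Sum.elim_inr] at hle hcard
  have h2 : (∑ x : Fin n, if G.Reachable (outerPt p) (Sum.inr (Sum.inl x)) then 2 else 0) =
      2 * ∑ x : Fin n, if G.Reachable (outerPt p) (Sum.inr (Sum.inl x)) then 1 else 0 := by
    rw [Finset.mul_sum]
    exact Finset.sum_congr rfl fun x _ => by split_ifs <;> rfl
  have e1 : ∀ i : Fin n, (outerPt (Sum.inl i) : GPoint n) = Sum.inl i := fun _ => rfl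
  have e2 : ∀ i : Fin n, (outerPt (Sum.inr i) : GPoint n) = Sum.inr (Sum.inr i) := fun _ => rfl
  simp only [e1, e2]
  omega

theorem IsMatching.stack {a b : Setoid (BPoint n)} (ha : IsMatching a) (hb : IsMatching b) :
    IsMatching (stack a b) := by
  classical
  intro p
  set G := glueGraph a b with hG
  let χ : GPoint n → ZMod 2 := fun x => if G.Reachable (outerPt p) x then 1 else 0
  have hχ : ∀ x y, G.Reachable x y → χ x = χ y := by
    intro x y h
    have : G.Reachable (outerPt p) x ↔ G.Reachable (outerPt p) y :=
      ⟨fun k => k.trans h, fun k => k.trans h.symm⟩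
    simp only [χ, this]
  have h1 := ha.sum_eq_zero (fun q => χ (upperPt q)) fun q r h => hχ _ _ (glue_upper h)
  have h2 := hb.sum_eq_zero (fun q => χ (lowerPt q)) fun q r h => hχ _ _ (glue_lower h)
  have h3 : ∑ q : BPoint n, χ (outerPt q) = 0 := by
    rw [Fintype.sum_sum_type] at h1 h2 ⊢
    change ∑ i, χ (Sum.inl i) + ∑ i, χ (Sum.inr (Sum.inl i)) = 0 at h1
    change ∑ i, χ (Sum.inr (Sum.inl i)) + ∑ i, χ (Sum.inr (Sum.inr i)) = 0 at h2
    change ∑ i, χ (Sum.inl i) + ∑ i, χ (Sum.inr (Sum.inr i)) = 0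
    have h4 := CharTwo.add_self_eq_zero (∑ i, χ (Sum.inr (Sum.inl i)))
    linear_combination h1 + h2 - h4
  set s := Finset.univ.filter fun q : BPoint n => G.Reachable (outerPt p) (outerPt q) with hs
  have hle : s.card ≤ 2 := stack_class_card_le ha hb p
  have heven : Even s.card := by
    rw [← ZMod.natCast_eq_zero_iff_even, hs, Finset.card_filter]
    push_cast
    exact h3
  have hp : p ∈ s := by simp [hs]
  have hpos : 0 < s.card := Finset.card_pos.2 ⟨p, hp⟩
  have htwo : s.card = 2 := by
    obtain ⟨k, hk⟩ := heven
    omega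
  have herase : (s.erase p).card = 1 := by rw [Finset.card_erase_of_mem hp, htwo]
  obtain ⟨q, hq⟩ := Finset.card_eq_one.1 herase
  have hiff : ∀ r, (r ≠ p ∧ _root_.stack a b p r) ↔ r = q := by
    intro r
    rw [← Finset.mem_singleton, ← hq, Finset.mem_erase, hs, Finset.mem_filter]
    exact ⟨fun h => ⟨h.1, Finset.mem_univ _, h.2⟩, fun h => ⟨h.1, h.2.2⟩⟩
  exact ⟨q, (hiff q).2 rfl, fun r hr => (hiff r).1 hr⟩

theorem IsCrossingless.stack {a b : Setoid (BPoint n)} (ha : IsMatching a) (hb : IsMatching b)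
    (hca : IsCrossingless a) (hcb : IsCrossingless b) : IsCrossingless (stack a b) := by
  classical
  rintro p q r s hpq hqr hrs ⟨hpr, hqs⟩
  have hab := ha.stack hb
  set G := glueGraph a b with hG
  let χ : GPoint n → ZMod 2 := fun x => if G.Reachable (outerPt p) x then 1 else 0
  have hχ : ∀ x y, G.Reachable x y → χ x = χ y := by
    intro x y h
    have : G.Reachable (outerPt p) x ↔ G.Reachable (outerPt p) y :=
      ⟨fun k => k.trans h, fun k => k.trans h.symm⟩
    simp only [χ, this]
  let g : GPoint n → ZMod 2 := Sum.elim (fun i => ∑ j, if j < i then χ (Sum.inl j) else 0)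
    (Sum.elim
      (fun i => (∑ j, χ (Sum.inl j)) + ∑ j, if i < j then χ (Sum.inr (Sum.inl j)) else 0)
      (fun i => (∑ j, χ (Sum.inl j)) + ∑ j, if i < j then χ (Sum.inr (Sum.inr j)) else 0))
  have hgu : ∀ x, g (upperPt x) = posSum (fun z => χ (upperPt z)) x := by
    rintro (i | i)
    · rw [posSum_inl]; rfl
    · rw [posSum_inr]; rfl
  have hgo : ∀ x, g (outerPt x) = posSum (fun z => χ (outerPt z)) x := by
    rintro (i | i)
    · rw [posSum_inl]; rfl
    · rw [posSum_inr]; rfl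
  have hgl : ∀ x, χ (lowerPt x) = 0 → g (lowerPt x) = posSum (fun z => χ (lowerPt z)) x +
      (∑ j, χ (Sum.inl j) + ∑ j, χ (Sum.inr (Sum.inl j))) := by
    rintro (i | i) hi
    · rw [posSum_inl]
      change χ (Sum.inr (Sum.inl i)) = 0 at hi
      change (∑ j, χ (Sum.inl j)) + ∑ j, (if i < j then χ (Sum.inr (Sum.inl j)) else 0) =
        (∑ j, if j < i then χ (Sum.inr (Sum.inl j)) else 0) +
          (∑ j, χ (Sum.inl j) + ∑ j, χ (Sum.inr (Sum.inl j)))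
      have hsplit : ∑ j, χ (Sum.inr (Sum.inl j)) =
          (∑ j, if j < i then χ (Sum.inr (Sum.inl j)) else 0) +
            ∑ j, (if i < j then χ (Sum.inr (Sum.inl j)) else 0) := by
        rw [← Finset.sum_add_distrib]
        refine Finset.sum_congr rfl fun j _ => ?_
        rcases lt_trichotomy j i with h | h | h
        · simp [h, h.le]
        · subst h; simp [hi]
        · simp [h, h.le]
      have h4 := CharTwo.add_self_eq_zero (∑ j, if j < i then χ (Sum.inr (Sum.inl j)) else 0)
      linear_combination - h4 - hsplit
    · rw [posSum_inr]
      change (∑ j, χ (Sum.inl j)) + ∑ j, (if i < j then χ (Sum.inr (Sum.inr j)) else 0) =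
        ((∑ j, χ (Sum.inr (Sum.inl j))) + ∑ j, if i < j then χ (Sum.inr (Sum.inr j)) else 0) +
          (∑ j, χ (Sum.inl j) + ∑ j, χ (Sum.inr (Sum.inl j)))
      have h4 := CharTwo.add_self_eq_zero (∑ j, χ (Sum.inr (Sum.inl j)))
      linear_combination - h4
  have htrans : ∀ x y, G.Reachable x y → (χ x = χ y ∧ (χ x = 0 → g x = g y)) := by
    intro x y hxy
    refine glue_induction (S := fun x y => χ x = χ y ∧ (χ x = 0 → g x = g y))
      ⟨fun _ => ⟨rfl, fun _ => rfl⟩, fun h => ⟨h.1.symm, fun k => (h.2 (h.1.trans k)).symm⟩,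
        fun h k => ⟨h.1.trans k.1, fun e => (h.2 e).trans (k.2 (h.1.symm.trans e))⟩⟩ ?_ ?_ hxy
    · intro u v huv
      refine ⟨hχ _ _ (glue_upper huv), fun h0 => ?_⟩
      rw [hgu, hgu]
      exact posSum_eq ha hca _ (fun z t h => hχ _ _ (glue_upper h)) huv h0
    · intro u v huv
      have he := hχ _ _ (glue_lower (a := a) huv)
      refine ⟨he, fun h0 => ?_⟩
      rw [hgl u h0, hgl v (he.symm.trans h0)]
      rw [posSum_eq hb hcb _ (fun z t h => hχ _ _ (glue_lower h)) huv h0]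
  obtain ⟨t, -, ht⟩ := hab p
  have hr : r = t := ht r ⟨fun e => by rw [e] at hqr; omega, hpr⟩
  have hval : ∀ z, χ (outerPt z) = (if z = p then 1 else 0) + (if z = r then 1 else 0) := by
    intro z
    have hne : p ≠ r := fun e => by rw [← e] at hqr; omega
    by_cases hzp : z = p
    · subst hzp
      simp [χ, hne]
    · by_cases hzr : z = r
      · subst hzr
        have : G.Reachable (outerPt p) (outerPt z) := hpr
        simp [χ, hzp, this]
      · have : ¬ G.Reachable (outerPt p) (outerPt z) := fun h =>
          hzr ((ht z ⟨hzp, h⟩).trans hr.symm)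
        simp [χ, hzp, hzr, this]
  have hq0 : χ (outerPt q) = 0 := by
    rw [hval, if_neg (fun e => by rw [e] at hpq; omega), if_neg (fun e => by rw [e] at hqr; omega),
      add_zero]
  have hfin := (htrans _ _ hqs).2 hq0
  rw [hgo, hgo] at hfin
  have hps : ∀ x, posSum (fun z => χ (outerPt z)) x =
      (if bpos p < bpos x then 1 else 0) + (if bpos r < bpos x then 1 else 0) := by
    intro x
    exact posSum_pair (fun e => by rw [← e] at hqr; omega) hval x
  rw [hps, hps, if_pos hpq, if_neg (by omega), if_pos (by omega), if_pos hrs] at hfin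
  revert hfin
  decide

theorem isMatching_id : IsMatching (idDiagram n) := by
  rintro (i | i)
  · refine ⟨Sum.inr i, ⟨by simp, rfl⟩, ?_⟩
    rintro (j | j) ⟨h1, h2⟩
    · have h2 : i = j := h2
      exact absurd (by rw [h2]) h1
    · have h2 : i = j := h2
      rw [h2]
  · refine ⟨Sum.inl i, ⟨by simp, rfl⟩, ?_⟩
    rintro (j | j) ⟨h1, h2⟩
    · have h2 : i = j := h2
      rw [h2]
    · have h2 : i = j := h2
      exact absurd (by rw [h2]) h1

theorem isCrossingless_id : IsCrossingless (idDiagram n) := by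
  rintro (p | p) (q | q) (r | r) (s | s) h1 h2 h3 ⟨h4, h5⟩ <;>
    simp only [bpos, Sum.elim_inl, Sum.elim_inr] at h1 h2 h3 <;>
    (have h4 : p = r := h4
     have h5 : q = s := h5
     subst h4 h5
     omega)

end MatchingFacts

/-- The `m`-cyclic Temperley--Lieb monoid on `n` strands: crossingless matchings, with the number
of internal components counted modulo `m`. -/
def cyclicTL (m n : ℕ) : Submonoid (LoopDiagram m n) where
  carrier := {x | IsMatching x.skel ∧ IsCrossingless x.skel}
  mul_mem' hx hy := ⟨hx.1.stack hy.1, IsCrossingless.stack hx.1 hy.1 hx.2 hy.2⟩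
  one_mem' := ⟨isMatching_id, isCrossingless_id⟩

instance (m n : ℕ) [NeZero m] : Finite (LoopDiagram m n) := by
  have : Finite (Setoid (BPoint n)) :=
    Finite.of_injective (fun a : Setoid (BPoint n) => (fun p q => a p q))
      fun a b h => Setoid.ext fun p q => iff_of_eq (congrFun (congrFun h p) q)
  exact Finite.of_injective (fun x : LoopDiagram m n => (x.skel, x.loops)) fun x y h =>
    LoopDiagram.ext (congrArg Prod.fst h) (congrArg Prod.snd h)

/-- The number of through strands. -/
noncomputable def throughStrands {m n : ℕ} (x : cyclicTL m n) : ℕ :=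
  Nat.card {i : Fin n // ∃ j : Fin n, (x : LoopDiagram m n).skel (Sum.inl i) (Sum.inr j)}

/-- The diagrams with `k` through strands. -/
def throughCell (m n k : ℕ) : Set (cyclicTL m n) := {x | throughStrands x = k}

/-! ### Cell orders, ideals and cell subquotients -/

section Monoids

variable {S : Type*} [Monoid S]

/-- The two-sided cell order: `b` is a two-sided multiple of `a`. -/
def TwoSidedLE (a b : S) : Prop := ∃ c d, b = c * a * d

/-- The elements that lie above (an element of) the cell `J` in the two-sided cell order. -/
def cellsAbove (J : Set S) : Set S := {s | ∃ a ∈ J, TwoSidedLE a s}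

theorem cellsAbove_mul_left {J : Set S} {s : S} (t : S) (hs : s ∈ cellsAbove J) :
    t * s ∈ cellsAbove J := by
  obtain ⟨a, ha, c, d, rfl⟩ := hs
  exact ⟨a, ha, t * c, d, by simp only [mul_assoc]⟩

theorem cellsAbove_mul_right {J : Set S} {s : S} (t : S) (hs : s ∈ cellsAbove J) :
    s * t ∈ cellsAbove J := by
  obtain ⟨a, ha, c, d, rfl⟩ := hs
  exact ⟨a, ha, c, d * t, by simp only [mul_assoc]⟩

/-- The `J`-submonoid: the elements above the cell `J`, together with the identity. -/
def cellSubmonoid (J : Set S) : Submonoid S where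
  carrier := cellsAbove J ∪ {1}
  mul_mem' {x y} hx hy := by
    rcases hx with hx | hx
    · exact Or.inl (cellsAbove_mul_right y hx)
    · rw [Set.mem_singleton_iff.1 hx, one_mul]
      exact hy
  one_mem' := Or.inr rfl

/-- The congruence on the `J`-submonoid that identifies all elements above the cell `K` with each
other and nothing else. -/
def cellCon (J K : Set S) : Con (cellSubmonoid J) where
  r x y := x = y ∨ ((x : S) ∈ cellsAbove K ∧ (y : S) ∈ cellsAbove K)
  iseqv := by
    refine ⟨fun x => Or.inl rfl, ?_, ?_⟩
    · rintro x y (h | h)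
      · exact Or.inl h.symm
      · exact Or.inr ⟨h.2, h.1⟩
    · rintro x y z (rfl | h) (rfl | h')
      · exact Or.inl rfl
      · exact Or.inr h'
      · exact Or.inr h
      · exact Or.inr ⟨h.1, h'.2⟩
  mul' := by
    rintro w x y z (rfl | h) (rfl | h')
    · exact Or.inl rfl
    · exact Or.inr ⟨cellsAbove_mul_left _ h'.1, cellsAbove_mul_left _ h'.2⟩
    · exact Or.inr ⟨cellsAbove_mul_right _ h.1, cellsAbove_mul_right _ h.2⟩
    · exact Or.inr ⟨cellsAbove_mul_right _ h.1, cellsAbove_mul_right _ h.2⟩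

/-- The cell subquotient: the Rees factor of the `J`-submonoid by the ideal of all elements above
`K`, all of which become a zero element. If `K` is empty, this is the `J`-submonoid itself, and
no zero element is added. -/
abbrev CellSubquotient (J K : Set S) : Type _ := (cellCon J K).Quotient

/-! ### Connectedness -/

/-- Every non-invertible element is a product of two non-invertible elements. -/
def IsNullConnected (S : Type*) [Monoid S] : Prop :=
  ∀ a : S, ¬ IsUnit a → ∃ b c : S, ¬ IsUnit b ∧ ¬ IsUnit c ∧ a = b * c

/-- The non-invertible elements form a single class of the equivalence relation generated by
`a * b ≈ a` for non-invertible `a`, `b`. -/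
def IsRightConnected (S : Type*) [Monoid S] : Prop :=
  (∃ a : S, ¬ IsUnit a) ∧ ∀ x y : S, ¬ IsUnit x → ¬ IsUnit y →
    Relation.EqvGen (fun s a : S => ∃ b, ¬ IsUnit a ∧ ¬ IsUnit b ∧ s = a * b) x y

/-- The non-invertible elements form a single class of the equivalence relation generated by
`b * a ≈ a` for non-invertible `a`, `b`. -/
def IsLeftConnected (S : Type*) [Monoid S] : Prop :=
  (∃ a : S, ¬ IsUnit a) ∧ ∀ x y : S, ¬ IsUnit x → ¬ IsUnit y →
    Relation.EqvGen (fun s a : S => ∃ b, ¬ IsUnit a ∧ ¬ IsUnit b ∧ s = b * a) x y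

end Monoids

/-! ### Representations and the representation gap -/

section Representations

variable (K : Type u) [Field K] (S : Type*) [Monoid S] [Finite S]

open Classical in
/-- The characters of the two trivial representations: the one of `𝟙_t` (for `true`) is constantly
`1`; the one of `𝟙_b` (for `false`) is `1` on the group of units and `0` elsewhere. -/
noncomputable def trivialChar (ε : Bool) : S →* K where
  toFun s := if ε = true ∨ IsUnit s then 1 else 0
  map_one' := by simp
  map_mul' s t := by
    have h : IsUnit (s * t) ↔ IsUnit s ∧ IsUnit t := by
      refine ⟨fun h => ?_, fun h => h.1.mul h.2⟩
      obtain ⟨u, hu⟩ := h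
      constructor
      · exact IsUnit.of_mul_eq_one (t * (↑u⁻¹ : S)) (by rw [← mul_assoc, ← hu, Units.mul_inv])
      · exact IsUnit.of_mul_eq_one_right ((↑u⁻¹ : S) * s) (by rw [mul_assoc, ← hu, Units.inv_mul])
    cases ε <;> by_cases hs : IsUnit s <;> by_cases ht : IsUnit t <;> simp [h, hs, ht]

/-- The direct sum of the trivial representations `𝟙_t` (where `ε i = true`) and `𝟙_b` (where
`ε i = false`). -/
noncomputable def trivialSum {r : ℕ} (ε : Fin r → Bool) : Representation K S (Fin r → K) where
  toFun s := LinearMap.pi fun i => trivialChar K S (ε i) s • LinearMap.proj i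
  map_one' := by
    ext
    simp
  map_mul' s t := by
    ext
    simp [mul_assoc]

variable {K S}

/-- The representation is isomorphic to a direct sum of trivial representations. -/
def IsTrivialSum {V : Type u} [AddCommGroup V] [Module K V] (ρ : Representation K S V) : Prop :=
  ∃ (r : ℕ) (ε : Fin r → Bool), Nonempty (ρ.Equiv (trivialSum K S ε))

/-- The representation is isomorphic to one of the two trivial representations. -/
def IsTrivialRep {V : Type u} [AddCommGroup V] [Module K V] (ρ : Representation K S V) : Prop :=
  ∃ ε : Fin 1 → Bool, Nonempty (ρ.Equiv (trivialSum K S ε))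

variable (K S)

/-- The pair `(S, K)` is `r`-trivial: every representation of dimension at most `r` is a direct sum
of trivial ones. By convention, the trivial monoid and the monoid `{1, a}` with `a ^ 2 = a`
(that is, the trivial group with a zero adjoined) are only `(-1)`-trivial. -/
def IsTrivialPair (r : ℤ) : Prop :=
  (0 ≤ r → IsEmpty (S ≃* Unit) ∧ IsEmpty (S ≃* WithZero Unit)) ∧
  ∀ (V : Type u) [AddCommGroup V] [Module K V] [Module.Finite K V] (ρ : Representation K S V),
    (Module.finrank K V : ℤ) ≤ r → IsTrivialSum ρ

/-- `g` is the representation gap of `(S, K)`: the greatest `r` such that `(S, K)` is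
`(r - 1)`-trivial. -/
def IsRepresentationGap (g : ℕ) : Prop :=
  IsGreatest {r : ℕ | IsTrivialPair K S ((r : ℤ) - 1)} g

/-- The dimensions of the simple representations that are not isomorphic to a trivial one. -/
def nontrivialSimpleDims : Set ℕ :=
  {d | ∃ (V : Type u) (_ : AddCommGroup V) (_ : Module K V) (_ : Module.Finite K V)
    (ρ : Representation K S V), ρ.IsIrreducible ∧ ¬ IsTrivialRep ρ ∧ Module.finrank K V = d}

end Representations

/-! ### The truncated monoid -/

/-- The truncated cyclic Temperley--Lieb monoid: diagrams with at most `l` through strands and the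
identity, where all diagrams with fewer than `k` through strands are identified to a zero element
(for `k < 2` there are none, and no zero element is added). -/
abbrev TruncatedTL (m n k l : ℕ) : Type :=
  CellSubquotient (throughCell m n l) {x : cyclicTL m n | throughStrands x + 2 = k}

instance (m n k l : ℕ) [NeZero m] : Finite (TruncatedTL m n k l) :=
  Finite.of_surjective _ Quotient.mk_surjective

/-!
Let `S` be well-connected without homomorphisms to `(K, +)`. If the non-invertible elements act
alike on a subrepresentation and on its quotient, then for non-invertible `c` the map
`a ↦ ρ (c a c) - ρ (c c)` is a homomorphism to `(End V, +)`, hence zero; left-connectedness,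
null-connectedness and right-connectedness then spread this to `ρ a = ρ b` for all non-invertible
`a` and `b`. Units act trivially because their `m`-th powers are `1` and `m ≠ 0` in `K`. By
induction on the dimension, a representation is a sum of trivial ones as soon as all its simple
constituents are trivial, so the gap is attained at a simple representation.

In the Temperley-Lieb monoid the cups of a diagram can be moved, one step at a time, to the right
end by multiplications that can be undone, so a diagram with at least `c` cups is a two-sided
multiple of the idempotent that has its `c` cups and `c` caps at the right end. By induction on `c`,
the diagrams with at least `c` cups are left-connected if at least three positions remain to the
left of this idempotent: generators at distance two or more commute, and there is room enough to
link any two generators by such steps. Loops form a group, so left-connectedness lifts from diagrams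
to diagrams with loops, and the flip exchanges left and right.
-/

universe v w

/-! ### Connectedness of monoids -/

section Connectedness

variable {S : Type v} {T : Type w} [Monoid S] [Monoid T] {I : Set S}

/-- The relation in the definition of `IsLeftConnected`, for a subset `I` in place of the
non-invertible elements. -/
def IsLeftConnectedSet (I : Set S) : Prop :=
  ∀ x y : S, x ∈ I → y ∈ I → Relation.EqvGen (fun s a => ∃ b, a ∈ I ∧ b ∈ I ∧ s = b * a) x y

theorem isLeftConnected_iff :
    IsLeftConnected S ↔ (nonunits S).Nonempty ∧ IsLeftConnectedSet (nonunits S) :=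
  Iff.rfl

theorem IsLeftConnectedSet.apply_eq {α : Type*} (hI : IsLeftConnectedSet I) {F : S → α}
    (hF : ∀ a ∈ I, ∀ b ∈ I, F (b * a) = F a) {x y : S} (hx : x ∈ I) (hy : y ∈ I) : F x = F y := by
  refine congrArg (Quot.lift F ?_) (Quot.eqvGen_sound (hI x y hx hy))
  rintro _ a ⟨b, ha, hb, rfl⟩
  exact hF a ha b hb

theorem isLeftConnectedSet_of_apply_eq
    (h : ∀ (α : Type v) (F : S → α), (∀ a ∈ I, ∀ b ∈ I, F (b * a) = F a) →
      ∀ x ∈ I, ∀ y ∈ I, F x = F y) :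
    IsLeftConnectedSet I := fun x y hx hy =>
  Quot.eqvGen_exact (h _ (Quot.mk _) (fun _ ha b hb => Quot.sound ⟨b, ha, hb, rfl⟩) x hx y hy)

theorem IsRightConnected.apply_eq {α : Type*} (hS : IsRightConnected S) {F : S → α}
    (hF : ∀ a ∈ nonunits S, ∀ b ∈ nonunits S, F (a * b) = F a) {x y : S} (hx : x ∈ nonunits S)
    (hy : y ∈ nonunits S) : F x = F y := by
  refine congrArg (Quot.lift F ?_) (Quot.eqvGen_sound (hS.2 x y hx hy))
  rintro _ a ⟨b, ha, hb, rfl⟩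
  exact hF a ha b hb

theorem isLeftConnectedSet_of_left_zero {z : S} (hz : z ∈ I) (h : ∀ a ∈ I, z * a = z) :
    IsLeftConnectedSet I := by
  refine isLeftConnectedSet_of_apply_eq fun _ F hF => ?_
  have hFz : ∀ a ∈ I, F a = F z := fun a ha => by rw [← hF a ha z hz, h a ha]
  exact fun x hx y hy => (hFz x hx).trans (hFz y hy).symm

theorem IsLeftConnectedSet.image (hI : IsLeftConnectedSet I) (φ : S →* T) :
    IsLeftConnectedSet (φ '' I) := by
  refine isLeftConnectedSet_of_apply_eq fun _ F hF => ?_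
  rintro _ ⟨x, hx, rfl⟩ _ ⟨y, hy, rfl⟩
  refine hI.apply_eq (F := F ∘ φ) (fun a ha b hb => ?_) hx hy
  rw [Function.comp_apply, map_mul]
  exact hF _ (Set.mem_image_of_mem φ ha) _ (Set.mem_image_of_mem φ hb)

theorem IsLeftConnectedSet.preimage (hI : IsLeftConnectedSet I) (hmul : ∀ a ∈ I, ∀ b ∈ I, b * a ∈ I)
    {φ : T →* S} (hrange : I ⊆ Set.range φ)
    (hlift : ∀ a ∈ I, ∀ x y, φ x = a * φ y → ∃ z, φ z = a ∧ x = z * y) :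
    IsLeftConnectedSet (φ ⁻¹' I) := by
  refine isLeftConnectedSet_of_apply_eq fun _ F hF => ?_
  have hfibre : ∀ x y, φ x ∈ I → φ x = φ y → F x = F y := by
    intro x y hx hxy
    obtain ⟨z, hz, hxz⟩ := hlift (φ x) hx (x * x) y (by rw [map_mul, ← hxy])
    rw [← hF x hx x hx, hxz]
    exact hF y (by rwa [Set.mem_preimage, ← hxy]) z (by rwa [Set.mem_preimage, hz])
  have hinv : ∀ a ∈ I, φ (Function.invFun φ a) = a := fun a ha => Function.invFun_eq (hrange ha)
  intro x hx y hy
  have hconst : F (Function.invFun φ (φ x)) = F (Function.invFun φ (φ y)) := by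
    refine hI.apply_eq (F := F ∘ Function.invFun φ) (fun a ha b hb => ?_) hx hy
    have hba : φ (Function.invFun φ (b * a)) = b * a := hinv _ (hmul a ha b hb)
    calc F (Function.invFun φ (b * a)) = F (Function.invFun φ b * Function.invFun φ a) :=
          hfibre _ _ (by rw [hba]; exact hmul a ha b hb)
            (by rw [hba, map_mul, hinv a ha, hinv b hb])
      _ = F (Function.invFun φ a) :=
          hF _ (by rwa [Set.mem_preimage, hinv a ha]) _ (by rwa [Set.mem_preimage, hinv b hb])
  rwa [hfibre _ x (by rwa [hinv _ hx]) (hinv _ hx), hfibre _ y (by rwa [hinv _ hy]) (hinv _ hy)]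
    at hconst

theorem IsLeftConnected.isRightConnected [StarMul S] (hS : IsLeftConnected S) :
    IsRightConnected S := by
  refine ⟨hS.1, fun x y hx hy => Quot.eqvGen_exact ?_⟩
  have key := (isLeftConnected_iff.1 hS).2.apply_eq
    (F := fun a => Quot.mk (fun s a : S => ∃ b, ¬ IsUnit a ∧ ¬ IsUnit b ∧ s = a * b) (star a))
    (fun a ha b hb => Quot.sound
      ⟨star b, isUnit_star.not.2 ha, isUnit_star.not.2 hb, star_mul b a⟩)
    (x := star x) (y := star y) (isUnit_star.not.2 hx) (isUnit_star.not.2 hy)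
  simpa only [star_star] using key

/-- A monoid is well-connected if it is null-connected, left-connected and right-connected. -/
structure IsWellConnected (S : Type*) [Monoid S] : Prop where
  null : IsNullConnected S
  left : IsLeftConnected S
  right : IsRightConnected S

end Connectedness

/-! ### Representations on which all non-invertible elements act alike -/

section UnitDetermined

variable {K : Type u} [Field K] {S : Type v} [Monoid S] {V : Type w} [AddCommGroup V] [Module K V]

/-- The action of an element depends only on whether the element is invertible. This is an
intrinsic description of `IsTrivialSum`. -/
def IsUnitDetermined (ρ : Representation K S V) : Prop :=
  ∀ s t, (IsUnit s ↔ IsUnit t) → ρ s = ρ t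

theorem hom_multiplicative_eq_one (h : ∀ f : S →* Multiplicative K, f = 1)
    (f : S →* Multiplicative V) : f = 1 := by
  ext s
  refine (Module.forall_dual_apply_eq_zero_iff K _).1 fun φ => ?_
  exact ofAdd_eq_one.1
    (DFunLike.congr_fun (h ((AddMonoidHom.toMultiplicative φ.toAddMonoidHom).comp f)) s)

section Extension

variable {ρ : Representation K S V} {W : Submodule K V}

theorem apply_eq_one_of_isUnit_of_extension {m : ℕ} (hm : (m : K) ≠ 0)
    (hpow : ∀ a : Sˣ, a ^ m = 1) (hW : ∀ s, IsUnit s → ∀ w ∈ W, ρ s w = w)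
    (hVW : ∀ s, IsUnit s → ∀ v, ρ s v - v ∈ W) {s : S} (hs : IsUnit s) : ρ s = 1 := by
  ext v
  have hpow_apply : ∀ t : ℕ, ρ (s ^ t) v = v + (t : K) • (ρ s v - v) := by
    intro t
    induction t with
    | zero => simp
    | succ t ih =>
      rw [pow_succ', map_mul, Module.End.mul_apply, ih, map_add, map_smul,
        hW s hs _ (hVW s hs v)]
      push_cast
      module
  have hsm : s ^ m = 1 := by simpa using congrArg Units.val (hpow hs.unit)
  have h := hpow_apply m
  rw [hsm, map_one, Module.End.one_apply, left_eq_add, smul_eq_zero] at h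
  exact sub_eq_zero.1 (h.resolve_left hm)

theorem apply_eq_of_not_isUnit_of_extension [IsDedekindFiniteMonoid S] (hS : IsWellConnected S)
    (hhom : ∀ f : S →* Multiplicative K, f = 1)
    (hW : ∀ s t, ¬ IsUnit s → ¬ IsUnit t → ∀ w ∈ W, ρ s w = ρ t w)
    (hVW : ∀ s t, ¬ IsUnit s → ¬ IsUnit t → ∀ v, ρ s v - ρ t v ∈ W) {s t : S} (hs : ¬ IsUnit s)
    (ht : ¬ IsUnit t) : ρ s = ρ t := by
  have hmul : ∀ {a : S} (b : S), ¬ IsUnit a → ¬ IsUnit (b * a) := fun b ha h =>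
    ha (IsUnit.mul_iff.1 h).2
  have hmul_sub : ∀ a a' b c, ¬ IsUnit a → ¬ IsUnit a' → ¬ IsUnit b → ¬ IsUnit c →
      ρ a * (ρ b - ρ c) = ρ a' * (ρ b - ρ c) := fun a a' b c ha ha' hb hc =>
    LinearMap.ext fun v => hW a a' ha ha' _ (hVW b c hb hc v)
  -- `a ↦ ρ (c * a * c) - ρ (c * c)` is a homomorphism from `S` to the additive group of `End V`.
  have hleft : ∀ a c, ¬ IsUnit c → ρ (c * (a * c)) = ρ (c * c) := by
    intro a c hc
    let f : S →* Multiplicative (Module.End K V) :=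
      { toFun := fun a => Multiplicative.ofAdd (ρ c * (ρ (a * c) - ρ c))
        map_one' := by simp
        map_mul' := fun a b => by
          have hca : ¬ IsUnit (c * a) := fun h => hc (IsUnit.mul_iff.1 h).1
          have h := hmul_sub (c * a) c (b * c) c hca hc (hmul b hc) hc
          rw [← ofAdd_add, ← h]
          congr 1
          simp only [map_mul, mul_assoc, mul_sub]
          abel }
    have h := ofAdd_eq_one.1 (DFunLike.congr_fun (hom_multiplicative_eq_one hhom f) a)
    rwa [mul_sub, sub_eq_zero, ← map_mul, ← map_mul] at h
  have hconst : ∀ a b c, ¬ IsUnit a → ¬ IsUnit b → ¬ IsUnit c → ρ (a * b) = ρ (a * c) := by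
    intro a b c ha hb hc
    refine (isLeftConnected_iff.1 hS.left).2.apply_eq (F := fun x => ρ (a * x))
      (fun x hx y _ => ?_) hb hc
    have h := hmul_sub a x (y * x) x ha hx (hmul y hx) hx
    rw [mul_sub, mul_sub, ← map_mul, ← map_mul, ← map_mul, ← map_mul, hleft y x hx, sub_self] at h
    exact sub_eq_zero.1 h
  refine hS.right.apply_eq (F := ρ) (fun a ha b _ => ?_) hs ht
  obtain ⟨c, d, hc, hd, rfl⟩ := hS.null a ha
  rw [mul_assoc]
  exact hconst c _ d hc (fun h => hd (IsUnit.mul_iff.1 h).1) hd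

theorem isUnitDetermined_of_subrepresentation [IsDedekindFiniteMonoid S] {m : ℕ}
    (hm : (m : K) ≠ 0) (hpow : ∀ a : Sˣ, a ^ m = 1) (hS : IsWellConnected S)
    (hhom : ∀ f : S →* Multiplicative K, f = 1) (U : Subrepresentation ρ)
    (hU : IsUnitDetermined U.toRepresentation)
    (hVU : IsUnitDetermined (ρ.quotient U.toSubmodule fun s v hv =>
      U.apply_mem_toSubmodule s hv)) :
    IsUnitDetermined ρ := by
  have hsub : ∀ s t, (IsUnit s ↔ IsUnit t) → ∀ w ∈ U.toSubmodule, ρ s w = ρ t w :=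
    fun s t hst w hw => congrArg Subtype.val (LinearMap.congr_fun (hU s t hst) ⟨w, hw⟩)
  have hquot : ∀ s t, (IsUnit s ↔ IsUnit t) → ∀ v, ρ s v - ρ t v ∈ U.toSubmodule :=
    fun s t hst v => (Submodule.Quotient.eq _).1
      (LinearMap.congr_fun (hVU s t hst) (Submodule.Quotient.mk v))
  have hunit : ∀ s, IsUnit s → ρ s = 1 := fun s hs => by
    have hs1 : ∀ a : S, IsUnit a → (IsUnit a ↔ IsUnit (1 : S)) :=
      fun _ ha => iff_of_true ha isUnit_one
    refine apply_eq_one_of_isUnit_of_extension (W := U.toSubmodule) hm hpow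
      (fun a ha w hw => ?_) (fun a ha v => ?_) hs
    · simpa using hsub a 1 (hs1 a ha) w hw
    · simpa using hquot a 1 (hs1 a ha) v
  intro s t hst
  by_cases hs : IsUnit s
  · rw [hunit s hs, hunit t (hst.1 hs)]
  · exact apply_eq_of_not_isUnit_of_extension hS hhom
      (fun s t hs ht => hsub s t (iff_of_false hs ht))
      (fun s t hs ht => hquot s t (iff_of_false hs ht)) hs (hst.not.1 hs)

end Extension

theorem isUnitDetermined_of_forall_isIrreducible [IsDedekindFiniteMonoid S] {m : ℕ}
    (hm : (m : K) ≠ 0) (hpow : ∀ a : Sˣ, a ^ m = 1) (hS : IsWellConnected S)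
    (hhom : ∀ f : S →* Multiplicative K, f = 1) {r : ℕ}
    (hirr : ∀ (V : Type w) [AddCommGroup V] [Module K V] [Module.Finite K V]
      (ρ : Representation K S V), Module.finrank K V ≤ r → ρ.IsIrreducible → IsUnitDetermined ρ)
    (V : Type w) [AddCommGroup V] [Module K V] [Module.Finite K V] (ρ : Representation K S V)
    (hr : Module.finrank K V ≤ r) : IsUnitDetermined ρ := by
  induction hd : Module.finrank K V using Nat.strong_induction_on generalizing V with
  | _ d ih =>
    by_cases hρ : ρ.IsIrreducible
    · exact hirr V ρ hr hρ
    rcases subsingleton_or_nontrivial V with _ | _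
    · exact fun _ _ _ => Subsingleton.elim _ _
    have hbt : (⊥ : Subrepresentation ρ) ≠ ⊤ := fun h =>
      bot_ne_top (α := Submodule K V) (congrArg Subrepresentation.toSubmodule h)
    have : Nontrivial (Subrepresentation ρ) := ⟨_, _, hbt⟩
    obtain ⟨U, hU⟩ : ∃ U : Subrepresentation ρ, ¬ (U = ⊥ ∨ U = ⊤) := by
      by_contra! h
      exact hρ ⟨h⟩
    rw [not_or] at hU
    have hfin := Submodule.finrank_quotient_add_finrank U.toSubmodule
    have hpos : 0 < Module.finrank K U.toSubmodule :=
      Nat.pos_of_ne_zero fun h => hU.1 (Subrepresentation.toSubmodule_injective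
        (Submodule.finrank_eq_zero.1 h))
    have hlt : Module.finrank K U.toSubmodule < Module.finrank K V :=
      Submodule.finrank_lt fun h => hU.2 (Subrepresentation.toSubmodule_injective h)
    exact isUnitDetermined_of_subrepresentation hm hpow hS hhom U
      (ih _ (by omega) _ _ (by omega) rfl) (ih _ (by omega) _ _ (by omega) rfl)

theorem exists_injective_representation (K : Type u) [Field K] (S : Type v) [Monoid S] [Finite S] :
    ∃ (V : Type u) (_ : AddCommGroup V) (_ : Module K V) (_ : Module.Finite K V)
      (ρ : Representation K S V), Function.Injective ρ := by
  let e : S ≃* Shrink.{0} S := Shrink.mulEquiv.symm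
  have : Finite (Shrink.{0} S) := Finite.of_equiv S e.toEquiv
  refine ⟨MonoidAlgebra K (Shrink.{0} S), inferInstance, inferInstance, inferInstance,
    (Representation.leftRegular K (Shrink.{0} S)).comp e.toMonoidHom, fun s t hst => ?_⟩
  have h := LinearMap.congr_fun hst (MonoidAlgebra.single 1 1)
  rw [MonoidHom.comp_apply, MonoidHom.comp_apply, Representation.ofMulAction_single,
    Representation.ofMulAction_single, smul_eq_mul, smul_eq_mul, mul_one, mul_one] at h
  exact e.injective (MonoidAlgebra.single_left_injective one_ne_zero h)

end UnitDetermined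

/-! ### Sums of trivial representations and the representation gap -/

section TrivialSum

variable {K : Type u} [Field K] {S : Type v} [Monoid S] [Finite S]

theorem trivialChar_congr (ε : Bool) {s t : S} (h : IsUnit s ↔ IsUnit t) :
    trivialChar K S ε s = trivialChar K S ε t := by
  classical exact if_congr (or_congr_right h) rfl rfl

variable {V : Type u} [AddCommGroup V] [Module K V] {ρ : Representation K S V}

theorem IsTrivialSum.isUnitDetermined (h : IsTrivialSum ρ) : IsUnitDetermined ρ := by
  obtain ⟨r, ε, ⟨e⟩⟩ := h
  have hcomm : ∀ s v, e.toLinearEquiv (ρ s v) = trivialSum K S ε s (e.toLinearEquiv v) :=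
    e.toIntertwiningMap.isIntertwining _ _
  intro s t hst
  ext v
  refine e.toLinearEquiv.injective (funext fun i => ?_)
  rw [hcomm, hcomm]
  simp only [trivialSum, MonoidHom.coe_mk, OneHom.coe_mk, LinearMap.pi_apply, LinearMap.smul_apply,
    trivialChar_congr _ hst]

theorem isTrivialSum_of_basis {ι : Type*} [Finite ι] (b : Module.Basis ι K V) (ε : ι → Bool)
    (h : ∀ s i, ρ s (b i) = trivialChar K S (ε i) s • b i) : IsTrivialSum ρ := by
  obtain ⟨r, ⟨f⟩⟩ := Finite.exists_equiv_fin ι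
  let b' := b.reindex f
  refine ⟨r, ε ∘ f.symm, ⟨.mk b'.equivFun fun s => b'.ext fun i => ?_⟩⟩
  ext j
  have hs : ρ s (b' i) = trivialChar K S (ε (f.symm i)) s • b' i := by
    simpa [b'] using h s _
  simp only [LinearMap.comp_apply, hs, map_smul]
  rcases eq_or_ne j i with rfl | hij
  · simp [trivialSum]
  · simp [trivialSum, hij.symm]

theorem isTrivialSum_of_isIdempotentElem [Module.Finite K V] {e : Module.End K V}
    (he : IsIdempotentElem e) (hunit : ∀ s, IsUnit s → ρ s = 1) (hnon : ∀ s, ¬ IsUnit s → ρ s = e) :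
    IsTrivialSum ρ := by
  have hc := LinearMap.IsIdempotentElem.isCompl he
  let b := ((Module.finBasis K e.range).prod (Module.finBasis K e.ker)).map
    (Submodule.prodEquivOfIsCompl _ _ hc)
  refine isTrivialSum_of_basis b Sum.isLeft fun s i => ?_
  by_cases hs : IsUnit s
  · simp [hunit s hs, trivialChar, hs]
  rw [hnon s hs]
  rcases i with i | i
  · obtain ⟨v, hv⟩ := (Module.finBasis K e.range i).2
    have hfix : e (e v) = e v := LinearMap.congr_fun he v
    simp [b, trivialChar, ← hv, hfix]
  · have hker : e (Module.finBasis K e.ker i) = 0 := (Module.finBasis K e.ker i).2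
    simp [b, trivialChar, hs, hker]

theorem IsUnitDetermined.isTrivialSum [Module.Finite K V] (h : IsUnitDetermined ρ) :
    IsTrivialSum ρ := by
  have hunit : ∀ s, IsUnit s → ρ s = 1 := fun s hs =>
    (h s 1 (iff_of_true hs isUnit_one)).trans (map_one ρ)
  by_cases hS : ∀ s : S, IsUnit s
  · exact isTrivialSum_of_isIdempotentElem .one hunit fun s hs => absurd (hS s) hs
  push Not at hS
  obtain ⟨a, ha⟩ := hS
  refine isTrivialSum_of_isIdempotentElem (e := ρ a) ?_ hunit fun s hs => h s a (iff_of_false hs ha)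
  rw [IsIdempotentElem, ← map_mul]
  exact h _ _ (iff_of_false (fun haa => ha (IsUnit.mul_iff.1 haa).1) ha)

theorem IsTrivialRep.isTrivialSum (h : IsTrivialRep ρ) : IsTrivialSum ρ := ⟨1, h⟩

theorem IsTrivialSum.isTrivialRep (h : IsTrivialSum ρ) (hρ : ρ.IsIrreducible) :
    IsTrivialRep ρ := by
  obtain ⟨r, ε, ⟨e⟩⟩ := h
  have hV : Nontrivial V := by
    by_contra hV
    rw [not_nontrivial_iff_subsingleton] at hV
    exact not_subsingleton (Subrepresentation ρ)
      ⟨fun _ _ => Subrepresentation.toSubmodule_injective (Subsingleton.elim _ _)⟩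
  have hr : Nonempty (Fin r) := by
    by_contra hr
    rw [not_nonempty_iff] at hr
    exact not_subsingleton V e.toLinearEquiv.toEquiv.subsingleton
  obtain ⟨i⟩ := hr
  let coord : (trivialSum K S ε).IntertwiningMap (trivialSum K S fun _ : Fin 1 => ε i) :=
    ⟨LinearMap.funLeft K K fun _ => i, fun _ => rfl⟩
  let f := coord.comp e.toIntertwiningMap
  have hsurj : Function.Surjective f :=
    (LinearMap.funLeft_surjective_of_injective K K (fun _ : Fin 1 => i)
      (Function.injective_of_subsingleton _)).comp e.toLinearEquiv.surjective
  have hne : f ≠ 0 := fun h => by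
    obtain ⟨v, hv⟩ := hsurj 1
    rw [h] at hv
    exact zero_ne_one (congrFun hv 0)
  exact ⟨_, ⟨f.ofBijective
    ⟨(Representation.IsIrreducible.injective_or_eq_zero f).resolve_right hne, hsurj⟩⟩⟩

theorem isEmpty_mulEquiv_of_nontrivial_nonunits {S : Type*} [Monoid S]
    (hne : (nonunits S).Nontrivial) : IsEmpty (S ≃* Unit) ∧ IsEmpty (S ≃* WithZero Unit) := by
  obtain ⟨s, hs, t, ht, hst⟩ := hne
  refine ⟨⟨fun e => hst (e.injective (Subsingleton.elim _ _))⟩, ⟨fun e => hst (e.injective ?_)⟩⟩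
  have hzero : ∀ a : S, ¬ IsUnit a → e a = 0 := fun a ha => by
    by_contra h
    exact ha ((MulEquiv.isUnit_map e).1 (IsUnit.mk0 _ h))
  exact (hzero s hs).trans (hzero t ht).symm

theorem isUnitDetermined_of_lt_nontrivialSimpleDims {m : ℕ} (hm : (m : K) ≠ 0)
    (hpow : ∀ a : Sˣ, a ^ m = 1) (hS : IsWellConnected S)
    (hhom : ∀ f : S →* Multiplicative K, f = 1) [Module.Finite K V]
    (hV : ∀ d ∈ nontrivialSimpleDims K S, Module.finrank K V < d) : IsUnitDetermined ρ := by
  refine isUnitDetermined_of_forall_isIrreducible hm hpow hS hhom (fun W _ _ _ σ hW hσ => ?_) V ρ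
    le_rfl
  by_contra hnot
  exact hW.not_gt (hV _ ⟨W, _, _, inferInstance, σ, hσ,
    fun h => hnot h.isTrivialSum.isUnitDetermined, rfl⟩)

theorem nonempty_nontrivialSimpleDims {m : ℕ} (hm : (m : K) ≠ 0)
    (hpow : ∀ a : Sˣ, a ^ m = 1) (hS : IsWellConnected S)
    (hhom : ∀ f : S →* Multiplicative K, f = 1) (hne : (nonunits S).Nontrivial) :
    (nontrivialSimpleDims K S).Nonempty := by
  by_contra hempty
  obtain ⟨s, hs, t, ht, hst⟩ := hne
  obtain ⟨V, _, _, _, ρ, hρ⟩ := exists_injective_representation K S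
  have hdet : IsUnitDetermined ρ := isUnitDetermined_of_lt_nontrivialSimpleDims hm hpow hS hhom
    fun d hd => absurd ⟨d, hd⟩ hempty
  exact hst (hρ (hdet s t (iff_of_false hs ht)))

theorem exists_isRepresentationGap {m : ℕ} (hm : (m : K) ≠ 0) (hpow : ∀ a : Sˣ, a ^ m = 1)
    (hS : IsWellConnected S) (hhom : ∀ f : S →* Multiplicative K, f = 1)
    (hne : (nonunits S).Nontrivial) :
    ∃ g : ℕ, IsRepresentationGap K S g ∧ IsLeast (nontrivialSimpleDims K S) g := by
  classical
  have hex := nonempty_nontrivialSimpleDims hm hpow hS hhom hne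
  have hleast : IsLeast (nontrivialSimpleDims K S) (sInf (nontrivialSimpleDims K S)) :=
    ⟨Nat.sInf_mem hex, fun _ hd => Nat.sInf_le hd⟩
  refine ⟨_, ⟨⟨fun _ => isEmpty_mulEquiv_of_nontrivial_nonunits hne, ?_⟩, ?_⟩, hleast⟩
  · intro V _ _ _ ρ hV
    refine (isUnitDetermined_of_lt_nontrivialSimpleDims hm hpow hS hhom
      fun d hd => ?_).isTrivialSum
    have := hleast.2 hd
    omega
  · intro r hr
    by_contra! hlt
    obtain ⟨V, _, _, _, ρ, hρ, hnot, hd⟩ := hleast.1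
    exact hnot ((hr.2 V ρ (by omega)).isTrivialRep hρ)

end TrivialSum

/-! ### The Jones monoid -/

section Reflection

variable {n : ℕ}

/-- The reflection of a diagram in a horizontal axis. -/
def reflect (a : Setoid (BPoint n)) : Setoid (BPoint n) := Setoid.comap Sum.swap a

theorem reflect_reflect (a : Setoid (BPoint n)) : reflect (reflect a) = a := by
  ext p q
  change a p.swap.swap q.swap.swap ↔ a p q
  rw [Sum.swap_swap, Sum.swap_swap]

theorem Colours.reflect {a : Setoid (BPoint n)} {f g : Fin n → Bool} (h : Colours a f g) :
    Colours (reflect a) g f := by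
  have elim_swap (p : BPoint n) : Sum.elim f g p.swap = Sum.elim g f p := by
    rcases p with i | i <;> rfl
  intro p q hpq
  rw [← elim_swap, ← elim_swap]
  exact h _ _ hpq

theorem colourMatrix_reflect (a : Setoid (BPoint n)) :
    colourMatrix (reflect a) = (colourMatrix a).transpose := by
  classical
  have colours_iff (f g : Fin n → Bool) : Colours (reflect a) f g ↔ Colours a g f :=
    ⟨fun h => reflect_reflect a ▸ h.reflect, Colours.reflect⟩
  ext f g
  simp only [colourMatrix, Matrix.transpose_apply, Matrix.of_apply, colours_iff]

theorem stack_reflect (a b : Setoid (BPoint n)) :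
    stackLoops (reflect b) (reflect a) = stackLoops a b ∧
      stack (reflect b) (reflect a) = reflect (stack a b) := by
  apply colourMatrix_smul_inj
  rw [← colourMatrix_mul, colourMatrix_reflect, colourMatrix_reflect, colourMatrix_reflect,
    ← Matrix.transpose_mul, colourMatrix_mul, Matrix.transpose_smul]

theorem IsMatching.reflect {a : Setoid (BPoint n)} (ha : IsMatching a) :
    IsMatching (reflect a) := by
  intro p
  obtain ⟨q, ⟨hqp, hpq⟩, hq⟩ := ha p.swap
  refine ⟨q.swap, ⟨fun e => hqp (by rw [← e, Sum.swap_swap]), ?_⟩, ?_⟩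
  · change a p.swap q.swap.swap
    rwa [Sum.swap_swap]
  · rintro r ⟨hrp, hpr⟩
    rw [← hq r.swap ⟨fun e => hrp (Sum.swap_leftInverse.injective e), hpr⟩, Sum.swap_swap]

theorem IsCrossingless.reflect {a : Setoid (BPoint n)} (ha : IsCrossingless a) :
    IsCrossingless (reflect a) := by
  have bpos_lt (p : BPoint n) : bpos p < 2 * n := by
    rcases p with i | i <;> simp only [bpos, Sum.elim_inl, Sum.elim_inr] <;> omega
  have bpos_swap (p : BPoint n) : bpos p.swap = 2 * n - 1 - bpos p := by
    rcases p with i | i <;> simp only [bpos, Sum.swap_inl, Sum.swap_inr, Sum.elim_inl, Sum.elim_inr]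
    omega
  have bpos_swap_lt {p q : BPoint n} (h : bpos p < bpos q) : bpos q.swap < bpos p.swap := by
    have := bpos_lt p
    have := bpos_lt q
    rw [bpos_swap, bpos_swap]
    omega
  exact fun p q r s hpq hqr hrs h => ha _ _ _ _ (bpos_swap_lt hrs) (bpos_swap_lt hqr)
    (bpos_swap_lt hpq) ⟨a.symm' h.2, a.symm' h.1⟩

end Reflection

/-- The Jones monoid: crossingless matchings, multiplied by stacking and discarding the closed
components. -/
@[ext]
structure JonesMonoid (n : ℕ) : Type where
  /-- Which boundary points are connected. -/
  rel : Setoid (BPoint n)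
  isMatching : IsMatching rel
  isCrossingless : IsCrossingless rel

namespace JonesMonoid

variable {n : ℕ}

noncomputable instance : Monoid (JonesMonoid n) where
  mul x y := ⟨stack x.rel y.rel, x.isMatching.stack y.isMatching,
    IsCrossingless.stack x.isMatching y.isMatching x.isCrossingless y.isCrossingless⟩
  one := ⟨idDiagram n, isMatching_id, isCrossingless_id⟩
  mul_assoc x y z := JonesMonoid.ext (stack_assoc x.rel y.rel z.rel).2
  one_mul x := JonesMonoid.ext (id_stack x.rel).2
  mul_one x := JonesMonoid.ext (stack_id x.rel).2

instance : StarMul (JonesMonoid n) where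
  star x := ⟨reflect x.rel, x.isMatching.reflect, x.isCrossingless.reflect⟩
  star_involutive x := JonesMonoid.ext (reflect_reflect x.rel)
  star_mul x y := JonesMonoid.ext (stack_reflect x.rel y.rel).2.symm

theorem partner_unique (x : JonesMonoid n) {p q r : BPoint n} (hq : x.rel p q) (hr : x.rel p r)
    (hqp : q ≠ p) (hrp : r ≠ p) : q = r :=
  (x.isMatching p).unique ⟨hqp, hq⟩ ⟨hrp, hr⟩

theorem exists_partner (x : JonesMonoid n) (p : BPoint n) : ∃ q, q ≠ p ∧ x.rel p q :=
  (x.isMatching p).exists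

theorem eq_of_common_partners {x y : JonesMonoid n}
    (h : ∀ p, ∃ r, r ≠ p ∧ x.rel p r ∧ y.rel p r) : x = y := by
  ext p q
  obtain ⟨r, hrp, hx, hy⟩ := h p
  by_cases hqp : q = p
  · rw [hqp]
    exact iff_of_true (x.rel.refl' p) (y.rel.refl' p)
  · exact ⟨fun hq => x.partner_unique hq hx hqp hrp ▸ hy,
      fun hq => y.partner_unique hq hy hqp hrp ▸ hx⟩

/-! ### Strands of a product -/

section Strands

variable {x y : JonesMonoid n} {i j k k' k'' : Fin n}

theorem mul_inl_inl (h : x.rel (Sum.inl i) (Sum.inl j)) : (x * y).rel (Sum.inl i) (Sum.inl j) :=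
  glue_upper h

theorem mul_inr_inr (h : y.rel (Sum.inr i) (Sum.inr j)) : (x * y).rel (Sum.inr i) (Sum.inr j) :=
  glue_lower h

theorem mul_inl_inr (h₁ : x.rel (Sum.inl i) (Sum.inr k)) (h₂ : y.rel (Sum.inl k) (Sum.inr j)) :
    (x * y).rel (Sum.inl i) (Sum.inr j) :=
  (glue_upper h₁).trans (glue_lower h₂)

theorem mul_inl_inr_of_zigzag (h₁ : x.rel (Sum.inl i) (Sum.inr k))
    (h₂ : y.rel (Sum.inl k) (Sum.inl k')) (h₃ : x.rel (Sum.inr k') (Sum.inr k''))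
    (h₄ : y.rel (Sum.inl k'') (Sum.inr j)) : (x * y).rel (Sum.inl i) (Sum.inr j) :=
  ((glue_upper h₁).trans (glue_lower h₂)).trans ((glue_upper h₃).trans (glue_lower h₄))

theorem mul_rel_of_vertical {p q : BPoint n} (h : x.rel p q)
    (hp : ∀ i, p = Sum.inr i → y.rel (Sum.inl i) (Sum.inr i))
    (hq : ∀ i, q = Sum.inr i → y.rel (Sum.inl i) (Sum.inr i)) : (x * y).rel p q := by
  have outer_reachable (p : BPoint n) (hp : ∀ i, p = Sum.inr i → y.rel (Sum.inl i) (Sum.inr i)) :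
      (glueGraph x.rel y.rel).Reachable (outerPt p) (upperPt p) := by
    rcases p with i | i
    · exact .refl _
    · exact (glue_lower (hp i rfl)).symm
  exact ((outer_reachable p hp).trans (glue_upper h)).trans (outer_reachable q hq).symm

end Strands

/-! ### Cup-cap diagrams -/

/-- The diagram `x` consists of a cup and a cap at the positions `a` and `b`, and vertical strands
at all other positions. -/
structure IsCupCap (x : JonesMonoid n) (a b : Fin n) : Prop where
  ne : a ≠ b
  top : x.rel (Sum.inl a) (Sum.inl b)
  bottom : x.rel (Sum.inr a) (Sum.inr b)
  vertical : ∀ i, i ≠ a → i ≠ b → x.rel (Sum.inl i) (Sum.inr i)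

namespace IsCupCap

variable {x y z : JonesMonoid n} {a b c d : Fin n}

theorem symm (hx : IsCupCap x a b) : IsCupCap x b a :=
  ⟨hx.ne.symm, x.rel.symm' hx.top, x.rel.symm' hx.bottom, fun i hb ha => hx.vertical i ha hb⟩

theorem eq_of_rel (hx : IsCupCap x a b) (htop : y.rel (Sum.inl a) (Sum.inl b))
    (hbottom : y.rel (Sum.inr a) (Sum.inr b))
    (hvertical : ∀ i, i ≠ a → i ≠ b → y.rel (Sum.inl i) (Sum.inr i)) : y = x := by
  refine eq_of_common_partners ?_
  rintro (i | i)
  · rcases eq_or_ne i a with rfl | hia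
    · exact ⟨Sum.inl b, by simpa using hx.ne.symm, htop, hx.top⟩
    rcases eq_or_ne i b with rfl | hib
    · exact ⟨Sum.inl a, by simpa using hx.ne, y.rel.symm' htop, hx.symm.top⟩
    · exact ⟨Sum.inr i, by simp, hvertical i hia hib, hx.vertical i hia hib⟩
  · rcases eq_or_ne i a with rfl | hia
    · exact ⟨Sum.inr b, by simpa using hx.ne.symm, hbottom, hx.bottom⟩
    rcases eq_or_ne i b with rfl | hib
    · exact ⟨Sum.inr a, by simpa using hx.ne, y.rel.symm' hbottom, hx.symm.bottom⟩
    · exact ⟨Sum.inl i, by simp, y.rel.symm' (hvertical i hia hib),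
        x.rel.symm' (hx.vertical i hia hib)⟩

theorem exists_top (hx : IsCupCap x a b) {i : Fin n} (hi : i = a ∨ i = b) :
    ∃ j, j ≠ i ∧ x.rel (Sum.inl i) (Sum.inl j) := by
  rcases hi with rfl | rfl
  · exact ⟨b, hx.ne.symm, hx.top⟩
  · exact ⟨a, hx.ne, hx.symm.top⟩

theorem star_eq (hx : IsCupCap x a b) : star x = x :=
  hx.eq_of_rel hx.bottom hx.top fun i ha hb => x.rel.symm' (hx.vertical i ha hb)

theorem mul_eq_left (hx : IsCupCap x a b) (hz : z.rel (Sum.inr a) (Sum.inr b)) : z * x = z := by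
  refine eq_of_common_partners fun p => ?_
  by_cases hpa : p = Sum.inr a
  · exact ⟨Sum.inr b, by simpa [hpa] using hx.ne.symm, hpa ▸ mul_inr_inr hx.bottom, hpa ▸ hz⟩
  by_cases hpb : p = Sum.inr b
  · exact ⟨Sum.inr a, by simpa [hpb] using hx.ne, hpb ▸ mul_inr_inr hx.symm.bottom,
      hpb ▸ z.rel.symm' hz⟩
  obtain ⟨r, hrp, hr⟩ := z.exists_partner p
  have hra : r ≠ Sum.inr a := fun e =>
    hpb (z.partner_unique (e ▸ z.rel.symm' hr) hz (e ▸ hrp.symm) (by simpa using hx.ne.symm))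
  have hrb : r ≠ Sum.inr b := fun e =>
    hpa (z.partner_unique (e ▸ z.rel.symm' hr) (z.rel.symm' hz) (e ▸ hrp.symm)
      (by simpa using hx.ne))
  have vertical_of_ne {q : BPoint n} (hqa : q ≠ Sum.inr a) (hqb : q ≠ Sum.inr b) (i : Fin n)
      (hi : q = Sum.inr i) : x.rel (Sum.inl i) (Sum.inr i) :=
    hx.vertical i (fun e => hqa (e ▸ hi)) (fun e => hqb (e ▸ hi))
  exact ⟨r, hrp, mul_rel_of_vertical hr (vertical_of_ne hpa hpb) (vertical_of_ne hra hrb), hr⟩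

theorem mul_self (hx : IsCupCap x a b) : x * x = x := hx.mul_eq_left hx.bottom

theorem mul_mul_self (hx : IsCupCap x a b) (hy : IsCupCap y b c) (hac : a ≠ c) :
    x * y * x = x := by
  have hxy_bottom : (x * y).rel (Sum.inr b) (Sum.inr c) := mul_inr_inr hy.bottom
  have hxy : (x * y).rel (Sum.inl c) (Sum.inr a) :=
    mul_inl_inr_of_zigzag (hx.vertical c hac.symm hy.ne.symm) hy.symm.top hx.symm.bottom
      (hy.vertical a hx.ne hac)
  refine hx.eq_of_rel (mul_inl_inl (mul_inl_inl hx.top)) (mul_inr_inr hx.bottom) fun i hia hib => ?_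
  rcases eq_or_ne i c with rfl | hic
  · exact mul_inl_inr_of_zigzag hxy hx.top hxy_bottom (hx.vertical i hia hib)
  · exact mul_inl_inr (mul_inl_inr (hx.vertical i hia hib) (hy.vertical i hib hic))
      (hx.vertical i hia hib)

theorem mul_comm (hx : IsCupCap x a b) (hy : IsCupCap y c d) (hac : a ≠ c) (had : a ≠ d)
    (hbc : b ≠ c) (hbd : b ≠ d) : x * y = y * x := by
  have hbottom : (x * y).rel (Sum.inr a) (Sum.inr b) :=
    mul_rel_of_vertical hx.bottom
      (fun i hi => Sum.inr_injective hi ▸ hy.vertical a hac had)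
      (fun i hi => Sum.inr_injective hi ▸ hy.vertical b hbc hbd)
  calc x * y = x * y * x := (hx.mul_eq_left hbottom).symm
    _ = star (x * y * x) := by simp only [star_mul, hx.star_eq, hy.star_eq, mul_assoc]
    _ = star (x * y) := by rw [hx.mul_eq_left hbottom]
    _ = y * x := by rw [star_mul, hx.star_eq, hy.star_eq]

end IsCupCap

/-- The partner of a boundary point in the diagram with a cup and a cap at `a` and `b`. -/
def cupCapPartner (a b : Fin n) : BPoint n → BPoint n :=
  Sum.elim (fun i => if i = a then Sum.inl b else if i = b then Sum.inl a else Sum.inr i)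
    (fun i => if i = a then Sum.inr b else if i = b then Sum.inr a else Sum.inl i)

theorem cupCapPartner_involutive (a b : Fin n) : Function.Involutive (cupCapPartner a b) := by
  rintro (i | i) <;> simp only [cupCapPartner, Sum.elim_inl, Sum.elim_inr] <;> split_ifs <;>
    simp_all

theorem exists_isCupCap {a b : Fin n} (hab : (a : ℕ) + 1 = b) :
    ∃ x : JonesMonoid n, IsCupCap x a b := by
  have hne : a ≠ b := by rintro rfl; omega
  have hne_symm : b ≠ a := hne.symm
  have partner_ne (p : BPoint n) : cupCapPartner a b p ≠ p := by
    rcases p with i | i <;> simp only [cupCapPartner, Sum.elim_inl, Sum.elim_inr] <;>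
      split_ifs <;> simp_all
  have partner_invol := cupCapPartner_involutive a b
  let rel : Setoid (BPoint n) :=
    { r := fun p q => q = p ∨ q = cupCapPartner a b p
      iseqv := ⟨fun p => Or.inl rfl, by rintro p q (rfl | rfl) <;> simp [partner_invol _], by
        rintro p q r (rfl | rfl) (rfl | rfl) <;> simp [partner_invol _]⟩ }
  have matching : IsMatching rel := fun p =>
    ⟨cupCapPartner a b p, ⟨partner_ne p, Or.inr rfl⟩, fun q hq => hq.2.resolve_left hq.1⟩
  have crossingless : IsCrossingless rel := by
    rintro p q r s hpq hqr hrs ⟨rfl | rfl, rfl | rfl⟩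
    · omega
    · omega
    · omega
    · rcases p with i | i <;> rcases q with j | j <;>
        simp only [cupCapPartner, bpos, Sum.elim_inl, Sum.elim_inr] at hpq hqr hrs <;>
        split_ifs at hqr hrs <;> simp only [Sum.elim_inl, Sum.elim_inr] at hqr hrs <;> omega
  refine ⟨⟨rel, matching, crossingless⟩, hne, Or.inr ?_, Or.inr ?_, fun i hia hib => Or.inr ?_⟩ <;>
    simp_all [cupCapPartner]

/-- The diagram with a cup and a cap at the positions `j` and `j + 1`, with the junk value `1` if
these are not positions. -/
noncomputable def cupCap (j : ℕ) : JonesMonoid n :=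
  if hj : j + 1 < n then (exists_isCupCap (a := ⟨j, by omega⟩) (b := ⟨j + 1, hj⟩) rfl).choose else 1

theorem isCupCap_cupCap {j : ℕ} (hj : j + 1 < n) :
    IsCupCap (cupCap j) (⟨j, by omega⟩ : Fin n) ⟨j + 1, hj⟩ := by
  rw [cupCap, dif_pos hj]
  exact (exists_isCupCap rfl).choose_spec

theorem cupCap_mul_self {j : ℕ} (hj : j + 1 < n) :
    (cupCap j : JonesMonoid n) * cupCap j = cupCap j := (isCupCap_cupCap hj).mul_self

theorem cupCap_comm {i j : ℕ} (hij : i + 2 ≤ j) (hj : j + 1 < n) :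
    (cupCap i : JonesMonoid n) * cupCap j = cupCap j * cupCap i := by
  apply (isCupCap_cupCap (by omega)).mul_comm (isCupCap_cupCap hj) <;>
    simp only [ne_eq, Fin.mk.injEq] <;> omega

/-! ### The number of through strands -/

section Rank

variable {x y : JonesMonoid n}

/-- The top end points of the through strands. -/
def throughTop (x : JonesMonoid n) : Set (Fin n) := {i | ∃ j, x.rel (Sum.inl i) (Sum.inr j)}

/-- The number of through strands. -/
noncomputable def rank (x : JonesMonoid n) : ℕ := x.throughTop.ncard

theorem notMem_throughTop_of_rel {i j : Fin n} (hij : x.rel (Sum.inl i) (Sum.inl j)) (hne : j ≠ i) :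
    i ∉ x.throughTop := by
  rintro ⟨k, hk⟩
  exact absurd (x.partner_unique hij hk (by simpa using hne) (by simp)) (by simp)

theorem throughTop_mul_subset (x y : JonesMonoid n) : (x * y).throughTop ⊆ x.throughTop := by
  intro i hi
  obtain ⟨p, hpi, hp⟩ := x.exists_partner (Sum.inl i)
  rcases p with j | j
  · exact absurd hi (notMem_throughTop_of_rel (mul_inl_inl hp) (by simpa using hpi))
  · exact ⟨j, hp⟩

theorem rank_mul_le_left (x y : JonesMonoid n) : rank (x * y) ≤ rank x :=
  Set.ncard_le_ncard (throughTop_mul_subset x y)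

theorem rank_le_rank_star (x : JonesMonoid n) : rank x ≤ rank (star x) := by
  choose! τ hτ using fun i (hi : i ∈ x.throughTop) => hi
  refine Set.ncard_le_ncard_of_injOn τ (fun i hi => ⟨i, x.rel.symm' (hτ i hi)⟩) ?_
  intro i hi j hj hij
  exact Sum.inl_injective (x.partner_unique (x.rel.symm' (hτ i hi))
    (x.rel.symm' (hij ▸ hτ j hj)) (by simp) (by simp))

theorem rank_star (x : JonesMonoid n) : rank (star x) = rank x :=
  le_antisymm (by simpa only [star_star] using rank_le_rank_star (star x)) (rank_le_rank_star x)

theorem rank_mul_le_right (x y : JonesMonoid n) : rank (x * y) ≤ rank y := by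
  rw [← rank_star, star_mul, ← rank_star y]
  exact rank_mul_le_left _ _

theorem rank_le (x : JonesMonoid n) : rank x ≤ n :=
  (Set.ncard_le_card x.throughTop).trans_eq (Nat.card_fin n)

theorem rank_one : rank (1 : JonesMonoid n) = n := by
  have h : (1 : JonesMonoid n).throughTop = Set.univ := Set.eq_univ_of_forall fun i => ⟨i, rfl⟩
  rw [rank, h, Set.ncard_univ, Nat.card_fin]

/-- Through strands do not cross, so they connect top to bottom in an increasing way; an increasing
self-map of a finite linear order is the identity. -/
theorem rel_inl_inr_self (h : (star x).throughTop = x.throughTop) {i : Fin n}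
    (hi : i ∈ x.throughTop) : x.rel (Sum.inl i) (Sum.inr i) := by
  choose τ hτ using fun i : x.throughTop => i.2
  have hτ_mem (i : x.throughTop) : τ i ∈ x.throughTop := h ▸ ⟨i, x.rel.symm' (hτ i)⟩
  have hmono : StrictMono fun i => (⟨τ i, hτ_mem i⟩ : x.throughTop) := by
    intro i j hij
    refine lt_of_not_ge fun hle => ?_
    rcases hle.lt_or_eq with hlt | heq
    · refine x.isCrossingless (Sum.inl i) (Sum.inl j) (Sum.inr (τ i)) (Sum.inr (τ j)) ?_ ?_ ?_
        ⟨hτ i, hτ j⟩ <;> simp only [bpos, Sum.elim_inl, Sum.elim_inr]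
      · exact hij
      · omega
      · have : τ j < τ i := hlt
        omega
    · have hτj := hτ j
      rw [Subtype.mk.inj heq] at hτj
      exact hij.ne (Subtype.ext (Sum.inl_injective (x.partner_unique (x.rel.symm' (hτ i))
        (x.rel.symm' hτj) (by simp) (by simp))))
  have hid := le_antisymm (hmono.apply_le (x := ⟨i, hi⟩)) hmono.le_apply
  have hτi : τ ⟨i, hi⟩ = i := congrArg Subtype.val hid
  simpa only [hτi] using hτ ⟨i, hi⟩

end Rank

/-! ### Idempotents with all cups at the right end -/

/-- The diagram with `c` cups and caps next to each other at the right end and `n - 2 * c` vertical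
strands to the left of them. -/
noncomputable def tail : ℕ → JonesMonoid n
  | 0 => 1
  | c + 1 => cupCap (n - 2 * c - 2) * tail c

section Tail

variable {x : JonesMonoid n} {c j : ℕ}

theorem tail_zero : (tail 0 : JonesMonoid n) = 1 := rfl

theorem tail_succ (c : ℕ) : (tail (c + 1) : JonesMonoid n) = cupCap (n - 2 * c - 2) * tail c := rfl

theorem cupCap_mul_tail (hj : j + 2 + 2 * c ≤ n) :
    (cupCap j : JonesMonoid n) * tail c = tail c * cupCap j := by
  induction c with
  | zero => rw [tail_zero, one_mul, mul_one]
  | succ c ih =>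
    rw [tail_succ, ← mul_assoc, cupCap_comm (by omega) (by omega), mul_assoc, ih (by omega),
      mul_assoc]

theorem tail_mul_self (hc : 2 * c ≤ n) : (tail c : JonesMonoid n) * tail c = tail c := by
  induction c with
  | zero => rw [tail_zero, one_mul]
  | succ c ih =>
    rw [tail_succ, mul_assoc, ← mul_assoc (tail c), ← cupCap_mul_tail (by omega), mul_assoc,
      ih (by omega), ← mul_assoc, cupCap_mul_self (by omega)]

theorem star_tail (hc : 2 * c ≤ n) : star (tail c : JonesMonoid n) = tail c := by
  induction c with
  | zero => rw [tail_zero, star_one]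
  | succ c ih =>
    rw [tail_succ, star_mul, (isCupCap_cupCap (by omega)).star_eq, ih (by omega),
      cupCap_mul_tail (by omega)]

theorem tail_inl_inr {i : Fin n} (hi : i + 2 * c < n) :
    (tail c : JonesMonoid n).rel (Sum.inl i) (Sum.inr i) := by
  induction c with
  | zero => rfl
  | succ c ih =>
    refine mul_inl_inr ((isCupCap_cupCap (by omega)).vertical i ?_ ?_) (ih (by omega)) <;>
      simp only [ne_eq, Fin.ext_iff] <;> omega

theorem tail_inl_inl (hc : 2 * c ≤ n) {i : Fin n} (hi : n ≤ i + 2 * c) :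
    ∃ j, j ≠ i ∧ (tail c : JonesMonoid n).rel (Sum.inl i) (Sum.inl j) := by
  induction c with
  | zero => omega
  | succ c ih =>
    by_cases hic : n ≤ i + 2 * c
    · obtain ⟨j, hji, hj⟩ := ih (by omega) hic
      exact ⟨j, hji, by rw [tail_succ, cupCap_mul_tail (by omega)]; exact mul_inl_inl hj⟩
    · obtain ⟨j, hji, hj⟩ := (isCupCap_cupCap (n := n) (j := n - 2 * c - 2) (by omega)).exists_top
        (i := i) (by simp only [Fin.ext_iff]; omega)
      exact ⟨j, hji, mul_inl_inl hj⟩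

theorem throughTop_subset_of_tail_mul (hc : 2 * c ≤ n) (hx : tail c * x = x) :
    x.throughTop ⊆ {i : Fin n | i + 2 * c < n} := by
  intro i hi
  by_contra hic
  obtain ⟨j, hji, hj⟩ := tail_inl_inl hc (not_lt.1 hic)
  exact notMem_throughTop_of_rel (hx ▸ mul_inl_inl hj) hji hi

theorem ncard_setOf_add_lt (c : ℕ) : {i : Fin n | i + c < n}.ncard = n - c := by
  have h : {i : Fin n | i + c < n} = Set.range (Fin.castLE (Nat.sub_le n c)) := by
    ext i
    simp only [Fin.range_castLE, Set.mem_ofPred_eq]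
    omega
  rw [h, ← Nat.card_coe_set_eq, Nat.card_range_of_injective (Fin.castLE_injective _),
    Nat.card_fin]

theorem rank_le_of_tail_mul (hc : 2 * c ≤ n) (hx : tail c * x = x) : rank x ≤ n - 2 * c := by
  rw [← ncard_setOf_add_lt]
  exact Set.ncard_le_ncard (throughTop_subset_of_tail_mul hc hx)

theorem tail_mul_star (hc : 2 * c ≤ n) (hx : x * tail c = x) : tail c * star x = star x := by
  rw [← star_tail hc, ← star_mul, hx]

theorem rank_le_of_mul_tail (hc : 2 * c ≤ n) (hx : x * tail c = x) : rank x ≤ n - 2 * c :=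
  rank_star x ▸ rank_le_of_tail_mul hc (tail_mul_star hc hx)

theorem rank_tail (hc : 2 * c ≤ n) : rank (tail c : JonesMonoid n) = n - 2 * c := by
  refine le_antisymm (rank_le_of_tail_mul hc (tail_mul_self hc)) ?_
  rw [← ncard_setOf_add_lt]
  exact Set.ncard_le_ncard fun i hi => ⟨i, tail_inl_inr hi⟩

theorem eq_tail_of_le_rank (hc : 2 * c ≤ n) (hl : tail c * x = x) (hr : x * tail c = x)
    (hx : n - 2 * c ≤ rank x) : x = tail c := by
  have throughTop_eq {y : JonesMonoid n} (hy : tail c * y = y) (hrank : n - 2 * c ≤ rank y) :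
      y.throughTop = {i : Fin n | i + 2 * c < n} :=
    Set.eq_of_subset_of_ncard_le (throughTop_subset_of_tail_mul hc hy)
      (by rwa [ncard_setOf_add_lt])
  have htop := throughTop_eq hl hx
  have hstar := throughTop_eq (tail_mul_star hc hr) (by rwa [rank_star])
  refine eq_of_common_partners ?_
  rintro (i | i) <;> rcases lt_or_ge (i + 2 * c) n with hi | hi
  · exact ⟨Sum.inr i, by simp, rel_inl_inr_self (hstar.trans htop.symm) (htop ▸ hi),
      tail_inl_inr hi⟩
  · obtain ⟨j, hji, hj⟩ := tail_inl_inl hc hi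
    exact ⟨Sum.inl j, by simpa using hji, hl ▸ mul_inl_inl hj, hj⟩
  · exact ⟨Sum.inl i, by simp,
      x.rel.symm' (rel_inl_inr_self (hstar.trans htop.symm) (htop ▸ hi)),
      (tail c).rel.symm' (tail_inl_inr hi)⟩
  · obtain ⟨j, hji, hj⟩ := tail_inl_inl hc hi
    rw [← star_tail hc] at hj
    exact ⟨Sum.inr j, by simpa using hji, hr ▸ mul_inr_inr hj, hj⟩

end Tail

/-! ### Moving cups to the right end -/

section Cups

variable {x : JonesMonoid n} {c j : ℕ}

theorem exists_adjacent_cup {p q : Fin n} (hpq : p < q) (h : x.rel (Sum.inr p) (Sum.inr q)) :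
    ∃ (j : ℕ) (hj : j + 1 < n), j + 1 ≤ q ∧
      x.rel (Sum.inr ⟨j, by omega⟩) (Sum.inr ⟨j + 1, hj⟩) := by
  induction hd : (q : ℕ) - p using Nat.strong_induction_on generalizing p q with
  | _ d ih =>
    obtain hadj | hgap : (q : ℕ) = p + 1 ∨ (p : ℕ) + 1 < q := by omega
    · exact ⟨p, by omega, hadj.ge, by rwa [show q = ⟨p + 1, by omega⟩ from Fin.ext hadj] at h⟩
    have hp1 : (p : ℕ) + 1 < n := by omega
    obtain ⟨t, ht, hxt⟩ := x.exists_partner (Sum.inr ⟨p + 1, hp1⟩)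
    have htp : t ≠ Sum.inr p := by
      rintro rfl
      have := x.partner_unique (x.rel.symm' hxt) h ht.symm (by simpa using hpq.ne')
      simp only [Sum.inr.injEq, Fin.ext_iff] at this
      omega
    have htq : t ≠ Sum.inr q := by
      rintro rfl
      have := x.partner_unique (x.rel.symm' hxt) (x.rel.symm' h) ht.symm (by simpa using hpq.ne)
      simp only [Sum.inr.injEq, Fin.ext_iff] at this
      omega
    rcases t with k | k
    · refine absurd ⟨x.rel.symm' hxt, x.rel.symm' h⟩ (x.isCrossingless _ _ _ _ ?_ ?_ ?_) <;>
        simp only [bpos, Sum.elim_inl, Sum.elim_inr] <;> omega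
    simp only [ne_eq, Sum.inr.injEq, Fin.ext_iff] at ht htp htq
    have hpk : (p : ℕ) < k := by
      by_contra hkp
      refine x.isCrossingless _ _ _ _ ?_ ?_ ?_ ⟨x.rel.symm' h, hxt⟩ <;>
        simp only [bpos, Sum.elim_inr] <;> omega
    have hkq : (k : ℕ) < q := by
      by_contra hqk
      refine x.isCrossingless _ _ _ _ ?_ ?_ ?_ ⟨x.rel.symm' hxt, x.rel.symm' h⟩ <;>
        simp only [bpos, Sum.elim_inr] <;> omega
    obtain ⟨j, hj, hjk, hxj⟩ := ih (k - (p + 1)) (by omega) (p := ⟨p + 1, hp1⟩) (q := k)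
      (by rw [Fin.lt_def]; simp only; omega) hxt rfl
    exact ⟨j, hj, by omega, hxj⟩

theorem exists_mul_cupCap_eq (hc : 2 * c ≤ n) (hx : x * tail c = x) (hrank : rank x + 2 * c < n) :
    ∃ j, j + 2 + 2 * c ≤ n ∧ x * cupCap j = x := by
  have not_subset : ¬ {i : Fin n | i + 2 * c < n} ⊆ (star x).throughTop := fun hsub => by
    have := Set.ncard_le_ncard hsub
    rw [ncard_setOf_add_lt] at this
    change _ ≤ rank (star x) at this
    rw [rank_star] at this
    omega
  obtain ⟨i, hi, hix⟩ := Set.not_subset.1 not_subset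
  obtain ⟨t | t, hti, hxt⟩ := x.exists_partner (Sum.inr i)
  · exact absurd ⟨t, hxt⟩ hix
  have htc : t + 2 * c < n := by
    by_contra htc
    obtain ⟨s, hst, hs⟩ := tail_inl_inl hc (not_lt.1 htc)
    have hxs : x.rel (Sum.inr t) (Sum.inr s) := by
      rw [← hx]
      exact mul_inr_inr (star_tail hc ▸ hs)
    obtain rfl : s = i := Sum.inr_injective <|
      x.partner_unique hxs (x.rel.symm' hxt) (by simpa using hst) hti.symm
    exact Sum.inl_ne_inr <| (tail c).partner_unique (Setoid.symm' _ hs) (tail_inl_inr hi)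
      (by simpa using hst.symm) Sum.inr_ne_inl
  have hic : i + 2 * c < n := hi
  have hne : t ≠ i := fun h => hti (congrArg Sum.inr h)
  rcases hne.lt_or_gt with hlt | hgt
  · obtain ⟨j, hj, hji, hxj⟩ := exists_adjacent_cup hlt (x.rel.symm' hxt)
    exact ⟨j, by omega, (isCupCap_cupCap hj).mul_eq_left hxj⟩
  · obtain ⟨j, hj, hjt, hxj⟩ := exists_adjacent_cup hgt hxt
    exact ⟨j, by omega, (isCupCap_cupCap hj).mul_eq_left hxj⟩

/-- Multiplication by `cupCap (j + 1)` moves the cup one step to the right, and multiplication by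
`cupCap j` moves it back. -/
theorem exists_mul_tail_succ_eq (hj : j + 2 + 2 * c ≤ n) (hx : x * tail c = x)
    (hxj : x * cupCap j = x) :
    ∃ q q', x * q * tail (c + 1) = x * q ∧ x * q * q' = x := by
  induction hd : n - 2 * c - 2 - j generalizing j x with
  | zero =>
    obtain rfl : j = n - 2 * c - 2 := by omega
    exact ⟨1, 1, by rw [mul_one, tail_succ, ← mul_assoc, hxj, hx], by rw [mul_one, mul_one]⟩
  | succ d ih =>
    obtain ⟨q, q', hq, hq'⟩ := ih (j := j + 1) (x := x * cupCap (j + 1)) (by omega)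
      (by rw [mul_assoc, cupCap_mul_tail (by omega), ← mul_assoc, hx])
      (by rw [mul_assoc, cupCap_mul_self (by omega)]) (by omega)
    have hbraid : (cupCap j : JonesMonoid n) * cupCap (j + 1) * cupCap j = cupCap j :=
      (isCupCap_cupCap (by omega)).mul_mul_self (isCupCap_cupCap (by omega))
        (by simp only [ne_eq, Fin.mk.injEq]; omega)
    refine ⟨cupCap (j + 1) * q, q' * cupCap j, by rw [← mul_assoc, hq], ?_⟩
    calc x * (cupCap (j + 1) * q) * (q' * cupCap j)
        = x * cupCap (j + 1) * q * q' * cupCap j := by simp only [mul_assoc]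
      _ = x * cupCap j * cupCap (j + 1) * cupCap j := by rw [hq', hxj]
      _ = x * (cupCap j * cupCap (j + 1) * cupCap j) := by simp only [mul_assoc]
      _ = x := by rw [hbraid, hxj]

theorem exists_mul_tail_eq (hx : rank x + 2 * c ≤ n + 1) :
    2 * c ≤ n ∧ ∃ q q', x * q * tail c = x * q ∧ x * q * q' = x := by
  induction c with
  | zero => exact ⟨by omega, 1, 1, by rw [tail_zero, mul_one], by rw [mul_one, mul_one]⟩
  | succ c ih =>
    obtain ⟨hc, q, q', hq, hq'⟩ := ih (by omega)
    have := rank_mul_le_left x q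
    obtain ⟨j, hj, hqj⟩ := exists_mul_cupCap_eq hc hq (by omega)
    obtain ⟨r, r', hr, hr'⟩ := exists_mul_tail_succ_eq hj hq hqj
    exact ⟨by omega, q * r, r' * q', by rw [← mul_assoc, hr],
      by rw [← mul_assoc, ← mul_assoc, hr', hq']⟩

theorem exists_rank_add_two_mul (x : JonesMonoid n) : ∃ c, rank x + 2 * c = n := by
  have hx := rank_le x
  obtain ⟨hc, q, q', hq, hq'⟩ := exists_mul_tail_eq (x := x) (c := (n + 1 - rank x) / 2) (by omega)
  have hle := rank_le_of_mul_tail hc hq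
  have hge := rank_mul_le_left (x * q) q'
  rw [hq'] at hge
  exact ⟨(n + 1 - rank x) / 2, by omega⟩

theorem eq_one_of_rank_eq (hx : rank x = n) : x = 1 :=
  eq_tail_of_le_rank (c := 0) (by omega) (one_mul x) (mul_one x) (by omega)

theorem tail_mul_mul_tail (hc : 2 * c ≤ n) (hn : n ≤ 2 * c + 1) (x : JonesMonoid n) :
    tail c * x * tail c = tail c := by
  have hr : tail c * x * tail c * tail c = tail c * x * tail c := by
    rw [mul_assoc, tail_mul_self hc]
  refine eq_tail_of_le_rank hc (by simp only [← mul_assoc, tail_mul_self hc]) hr ?_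
  by_contra hlt
  obtain ⟨j, hj, -⟩ := exists_mul_cupCap_eq hc hr (by omega)
  omega

end Cups

/-! ### The ideals of the Jones monoid -/

/-- The two-sided ideal of the diagrams with at least `c` cups, that is, with at most `n - 2 * c`
through strands. -/
def rankIdeal (n c : ℕ) : Set (JonesMonoid n) := {x | rank x + 2 * c ≤ n}

section RankIdeal

variable {x y : JonesMonoid n} {c i j : ℕ}

theorem mul_mem_rankIdeal_left (hx : x ∈ rankIdeal n c) (y : JonesMonoid n) :
    x * y ∈ rankIdeal n c :=
  (Nat.add_le_add_right (rank_mul_le_left x y) _).trans hx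

theorem mul_mem_rankIdeal_right (x : JonesMonoid n) (hy : y ∈ rankIdeal n c) :
    x * y ∈ rankIdeal n c :=
  (Nat.add_le_add_right (rank_mul_le_right x y) _).trans hy

theorem tail_mem_rankIdeal (hc : 2 * c ≤ n) : tail c ∈ rankIdeal n c := by
  rw [rankIdeal, Set.mem_ofPred_eq, rank_tail hc]
  omega

theorem exists_eq_mul_tail_mul (hx : x ∈ rankIdeal n c) :
    ∃ p q, x = p * tail c * q := by
  obtain ⟨-, q, q', hq, hq'⟩ := exists_mul_tail_eq (x := x) (c := c) (Nat.le_succ_of_le hx)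
  exact ⟨x * q, q', by rw [hq, hq']⟩

theorem cupCap_mul_tail_mem_rankIdeal (hj : j + 2 + 2 * c ≤ n) :
    (cupCap j : JonesMonoid n) * tail c ∈ rankIdeal n (c + 1) := by
  obtain ⟨q, q', hq, hq'⟩ := exists_mul_tail_succ_eq (x := cupCap j * tail c) hj
    (by rw [mul_assoc, tail_mul_self (by omega)])
    (by rw [mul_assoc, ← cupCap_mul_tail hj, ← mul_assoc, cupCap_mul_self (by omega)])
  rw [← hq', ← hq]
  exact mul_mem_rankIdeal_left (mul_mem_rankIdeal_right _ (tail_mem_rankIdeal (by omega))) _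

theorem cupCap_mul_tail_mul (hj : j + 2 + 2 * c ≤ n) (x y : JonesMonoid n) :
    x * tail c * (cupCap j * tail c * y) = x * cupCap j * tail c * y := by
  calc x * tail c * (cupCap j * tail c * y)
      = x * (tail c * cupCap j) * tail c * y := by simp only [mul_assoc]
    _ = x * cupCap j * (tail c * tail c) * y := by
      rw [← cupCap_mul_tail hj]
      simp only [mul_assoc]
    _ = x * cupCap j * tail c * y := by rw [tail_mul_self (by omega)]

section LeftInvariant

variable {α : Type*} {F : JonesMonoid n → α}

/-- Generators with distant indices commute, and any two of the indices `0, …, n - 2 * c - 2` are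
joined by steps of length at least two. -/
theorem apply_cupCap_mul_eq (hn : 5 + 2 * c ≤ n)
    (hF : ∀ a ∈ rankIdeal n (c + 1), ∀ b ∈ rankIdeal n (c + 1), F (b * a) = F a)
    (hi : i + 2 + 2 * c ≤ n) (hj : j + 2 + 2 * c ≤ n) (q : JonesMonoid n) :
    F (cupCap i * tail c * q) = F (cupCap j * tail c * q) := by
  have far {i j : ℕ} (hij : i + 2 ≤ j) (hj : j + 2 + 2 * c ≤ n) :
      F (cupCap i * tail c * q) = F (cupCap j * tail c * q) := by
    have hmem {t : ℕ} (ht : t + 2 + 2 * c ≤ n) := cupCap_mul_tail_mem_rankIdeal ht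
    rw [← hF _ (mul_mem_rankIdeal_left (hmem (by omega)) q) _ (hmem hj),
      ← hF _ (mul_mem_rankIdeal_left (hmem hj) q) _ (hmem (t := i) (by omega)),
      cupCap_mul_tail_mul (by omega), cupCap_mul_tail_mul hj, cupCap_comm hij (by omega)]
  have zero {i : ℕ} (hi : i + 2 + 2 * c ≤ n) :
      F (cupCap i * tail c * q) = F (cupCap 0 * tail c * q) := by
    obtain rfl | rfl | hi2 : i = 0 ∨ i = 1 ∨ 2 ≤ i := by omega
    · rfl
    · exact (far (j := 3) le_rfl (by omega)).trans (far (by omega) (by omega)).symm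
    · exact (far (by omega) hi).symm
  exact (zero hi).trans (zero hj).symm

theorem apply_mul_eq_of_mem_rankIdeal (hn : 5 + 2 * c ≤ n)
    (hF : ∀ a ∈ rankIdeal n (c + 1), ∀ b ∈ rankIdeal n (c + 1), F (b * a) = F a)
    {z w : JonesMonoid n} (hz : z ∈ rankIdeal n (c + 1)) (hw : w ∈ rankIdeal n (c + 1))
    (hx : x ∈ rankIdeal n c) : F (z * x) = F (w * x) := by
  obtain ⟨p, q, rfl⟩ := exists_eq_mul_tail_mul hx
  have eq_zero {z : JonesMonoid n} (hz : z ∈ rankIdeal n (c + 1)) :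
      F (z * (p * tail c * q)) = F (cupCap 0 * tail c * q) := by
    have hzp := mul_mem_rankIdeal_left hz p
    have hrank : rank (z * p * tail c) + 2 * (c + 1) ≤ n := mul_mem_rankIdeal_left hzp (tail c)
    obtain ⟨j, hj, hzj⟩ := exists_mul_cupCap_eq (c := c) (by omega) (x := z * p * tail c)
      (by rw [mul_assoc, tail_mul_self (by omega)]) (by omega)
    calc F (z * (p * tail c * q)) = F (z * p * tail c * cupCap j * q) := by
          rw [hzj]
          simp only [mul_assoc]
      _ = F (z * p * (cupCap j * tail c * q)) := by
          rw [cupCap_mul_tail hj]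
          simp only [mul_assoc]
      _ = F (cupCap j * tail c * q) :=
          hF _ (mul_mem_rankIdeal_left (cupCap_mul_tail_mem_rankIdeal hj) q) _ hzp
      _ = F (cupCap 0 * tail c * q) := apply_cupCap_mul_eq hn hF hj (by omega) q
  rw [eq_zero hz, eq_zero hw]

end LeftInvariant

theorem isLeftConnectedSet_rankIdeal (hn : 3 + 2 * c ≤ n) :
    IsLeftConnectedSet (rankIdeal n c) := by
  refine isLeftConnectedSet_of_apply_eq ?_
  induction c with
  | zero =>
    intro α F hF x hx y hy
    have h1 : (1 : JonesMonoid n) ∈ rankIdeal n 0 := rank_one.le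
    rw [← mul_one x, ← mul_one y, hF 1 h1 x hx, hF 1 h1 y hy]
  | succ c ih =>
    intro α F hF x hx y hy
    have htail : tail (c + 1) ∈ rankIdeal n (c + 1) := tail_mem_rankIdeal (by omega)
    have hG := ih (by omega) α (fun x => F (tail (c + 1) * x)) fun a ha b _ => by
      rw [← mul_assoc]
      exact apply_mul_eq_of_mem_rankIdeal (by omega) hF (mul_mem_rankIdeal_left htail b) htail ha
    have hsub : rankIdeal n (c + 1) ⊆ rankIdeal n c := fun z (hz : _ ≤ n) =>
      show rank z + 2 * c ≤ n by omega
    rw [← hF x hx _ htail, ← hF y hy _ htail]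
    exact hG x (hsub hx) y (hsub hy)

end RankIdeal

end JonesMonoid

/-! ### Cell subquotients of monoids with involution -/

section StarCells

variable {S : Type*} [Monoid S] [StarMul S] {J K : Set S}

theorem star_mem_cellsAbove (hJ : ∀ a ∈ J, star a ∈ J) {s : S} (hs : s ∈ cellsAbove J) :
    star s ∈ cellsAbove J := by
  obtain ⟨a, ha, c, d, rfl⟩ := hs
  exact ⟨star a, hJ a ha, star d, star c, by simp only [star_mul, mul_assoc]⟩

theorem star_mem_cellSubmonoid (hJ : ∀ a ∈ J, star a ∈ J) {s : S} (hs : s ∈ cellSubmonoid J) :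
    star s ∈ cellSubmonoid J := by
  rcases hs with hs | rfl
  · exact Or.inl (star_mem_cellsAbove hJ hs)
  · rw [star_one]
    exact one_mem _

/-- The involution that the cell subquotient of two star-closed sets inherits. -/
abbrev CellSubquotient.starMul (hJ : ∀ a ∈ J, star a ∈ J) (hK : ∀ a ∈ K, star a ∈ K) :
    StarMul (CellSubquotient J K) where
  star := Quotient.map (fun x => ⟨star x.1, star_mem_cellSubmonoid hJ x.2⟩) fun _ _ h =>
    h.imp (fun h => by rw [h])
      fun h => ⟨star_mem_cellsAbove hK h.1, star_mem_cellsAbove hK h.2⟩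
  star_involutive := by
    rintro ⟨x⟩
    exact congrArg (Quotient.mk _) (Subtype.ext (star_star x.1))
  star_mul := by
    rintro ⟨x⟩ ⟨y⟩
    exact congrArg (Quotient.mk _) (Subtype.ext (star_mul x.1 y.1))

end StarCells

namespace TruncatedTL

open JonesMonoid

variable {m n k l : ℕ}

/-! ### Diagrams with loops -/

section Skeleton

instance : StarMul (cyclicTL m n) where
  star x := ⟨⟨reflect x.1.skel, x.1.loops⟩, x.2.1.reflect, x.2.2.reflect⟩
  star_involutive x := Subtype.ext (LoopDiagram.ext (reflect_reflect x.1.skel) rfl)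
  star_mul x y := by
    obtain ⟨hloops, hstack⟩ := stack_reflect x.1.skel y.1.skel
    refine Subtype.ext (LoopDiagram.ext hstack.symm ?_)
    change x.1.loops + y.1.loops + (stackLoops x.1.skel y.1.skel : ZMod m) =
      y.1.loops + x.1.loops + (stackLoops (reflect y.1.skel) (reflect x.1.skel) : ZMod m)
    rw [hloops, add_comm x.1.loops]

/-- The matching that underlies a diagram with loops. -/
def skeleton : cyclicTL m n →* JonesMonoid n where
  toFun x := ⟨x.1.skel, x.2.1, x.2.2⟩
  map_one' := rfl
  map_mul' _ _ := rfl

theorem rank_skeleton (x : cyclicTL m n) : rank (skeleton x) = throughStrands x := rfl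

theorem throughStrands_star (x : cyclicTL m n) : throughStrands (star x) = throughStrands x :=
  rank_star (skeleton x)

theorem ext_skeleton {x y : cyclicTL m n} (hskel : skeleton x = skeleton y)
    (hloops : x.1.loops = y.1.loops) : x = y :=
  Subtype.ext (LoopDiagram.ext (congrArg JonesMonoid.rel hskel) hloops)

theorem loops_mul (x y : cyclicTL m n) : (x * y).1.loops =
    x.1.loops + y.1.loops + (stackLoops (skeleton x).rel (skeleton y).rel : ZMod m) := rfl

theorem skeleton_surjective : Function.Surjective (skeleton : cyclicTL m n →* JonesMonoid n) :=
  fun a => ⟨⟨⟨a.rel, 0⟩, a.isMatching, a.isCrossingless⟩, rfl⟩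

/-- The loops form a group, so multiplying by a diagram can be undone as far as they go. -/
theorem exists_eq_mul {x y : cyclicTL m n} {a : JonesMonoid n}
    (h : skeleton x = a * skeleton y) : ∃ z, skeleton z = a ∧ x = z * y := by
  refine ⟨⟨⟨a.rel, x.1.loops - y.1.loops - (stackLoops a.rel (skeleton y).rel : ZMod m)⟩,
    a.isMatching, a.isCrossingless⟩, rfl, ext_skeleton h ?_⟩
  rw [loops_mul]
  change _ = x.1.loops - y.1.loops - (stackLoops a.rel (skeleton y).rel : ZMod m) + y.1.loops +
    (stackLoops a.rel (skeleton y).rel : ZMod m)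
  ring

theorem loops_pow_succ {x : cyclicTL m n} (h : skeleton x * skeleton x = skeleton x) (t : ℕ) :
    (x ^ (t + 1)).1.loops = (t + 1 : ZMod m) * x.1.loops +
      t * (stackLoops (skeleton x).rel (skeleton x).rel : ZMod m) := by
  induction t with
  | zero => rw [zero_add, pow_one, Nat.cast_zero, zero_add, one_mul, zero_mul, add_zero]
  | succ t ih =>
    rw [pow_succ, loops_mul, map_pow, IsIdempotentElem.pow_succ_eq t h, ih]
    push_cast
    ring

theorem pow_add_one_of_idempotent {x : cyclicTL m n} (h : skeleton x * skeleton x = skeleton x) :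
    x ^ (m + 1) = x := by
  refine ext_skeleton (by rw [map_pow, IsIdempotentElem.pow_succ_eq m h]) ?_
  rw [loops_pow_succ h, CharP.cast_eq_zero, zero_add, one_mul, zero_mul, add_zero]

theorem pow_eq_one {x : cyclicTL m n} (h : skeleton x = 1) : x ^ m = 1 := by
  obtain ⟨z, -, hz⟩ := exists_eq_mul (x := 1) (y := x) (a := 1) (by rw [h, map_one, mul_one])
  have hpow := pow_add_one_of_idempotent (x := x) (by rw [h, mul_one])
  calc x ^ m = z * x * x ^ m := by rw [← hz, one_mul]
    _ = z * x ^ (m + 1) := by rw [mul_assoc, pow_succ']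
    _ = 1 := by rw [hpow, ← hz]

end Skeleton

/-! ### The truncated monoid -/

section Cells

theorem throughStrands_le_of_mem_cellsAbove {x : cyclicTL m n}
    (hx : x ∈ cellsAbove (throughCell m n l)) : throughStrands x ≤ l := by
  obtain ⟨a, ha, y, z, rfl⟩ := hx
  have ha : throughStrands a = l := ha
  rw [← ha, ← rank_skeleton, map_mul, map_mul]
  exact (rank_mul_le_left _ _).trans (rank_mul_le_right _ _)

theorem mem_cellsAbove_throughCell (hl : l ≡ n [MOD 2]) (hln : l ≤ n) {x : cyclicTL m n}
    (hx : throughStrands x ≤ l) : x ∈ cellsAbove (throughCell m n l) := by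
  have hc : l + 2 * ((n - l) / 2) = n := by
    rw [Nat.ModEq] at hl
    omega
  obtain ⟨p, q, hpq⟩ := exists_eq_mul_tail_mul (x := skeleton x) (c := (n - l) / 2)
    (show throughStrands x + _ ≤ n by omega)
  obtain ⟨t, ht⟩ := skeleton_surjective (m := m) (tail ((n - l) / 2))
  obtain ⟨q', rfl⟩ := skeleton_surjective (m := m) q
  rw [mul_assoc, ← ht, ← map_mul] at hpq
  obtain ⟨p', -, rfl⟩ := exists_eq_mul hpq
  refine ⟨t, ?_, p', q', (mul_assoc _ _ _).symm⟩
  change rank (skeleton t) = l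
  rw [ht, rank_tail (by omega)]
  omega

end Cells

/-- The least positive number of cups of a diagram with at most `l` through strands, which is also
the least number of cups of a non-invertible diagram. -/
def minCups (n l : ℕ) : ℕ := max 1 ((n - l) / 2)

theorem mem_rankIdeal_minCups (hl : l ≡ n [MOD 2]) (hln : l ≤ n) {x : JonesMonoid n} :
    x ∈ rankIdeal n (minCups n l) ↔ rank x + 2 ≤ n ∧ rank x ≤ l := by
  rw [Nat.ModEq] at hl
  rw [rankIdeal, Set.mem_ofPred_eq, minCups]
  omega

/-- The skeletons of the diagrams before truncation from below. -/
noncomputable def shape : cellSubmonoid (throughCell m n l) →* JonesMonoid n :=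
  skeleton.comp (Submonoid.subtype _)

section Shape

variable {x y : cellSubmonoid (throughCell m n l)} {a : JonesMonoid n}

theorem exists_shape_eq (hl : l ≡ n [MOD 2]) (hln : l ≤ n) (ha : rank a ≤ l) :
    ∃ x : cellSubmonoid (throughCell m n l), shape x = a := by
  obtain ⟨x, rfl⟩ := skeleton_surjective (m := m) a
  exact ⟨⟨x, Or.inl (mem_cellsAbove_throughCell hl hln ha)⟩, rfl⟩

theorem exists_eq_mul_of_shape_eq (hl : l ≡ n [MOD 2]) (hln : l ≤ n) (ha : rank a ≤ l)
    (h : shape x = a * shape y) : ∃ z, shape z = a ∧ x = z * y := by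
  obtain ⟨z, rfl, hz⟩ := exists_eq_mul (x := x.1) (y := y.1) h
  exact ⟨⟨z, Or.inl (mem_cellsAbove_throughCell hl hln ha)⟩, rfl, Subtype.ext hz⟩

theorem shape_eq_one_or_mem_rankIdeal (hl : l ≡ n [MOD 2]) (hln : l ≤ n)
    (x : cellSubmonoid (throughCell m n l)) :
    shape x = 1 ∨ shape x ∈ rankIdeal n (minCups n l) := by
  refine or_iff_not_imp_left.2 fun hx => (mem_rankIdeal_minCups hl hln).2 ⟨?_, ?_⟩
  · obtain ⟨c, hc⟩ := exists_rank_add_two_mul (shape x)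
    have : rank (shape x) ≠ n := fun h => hx (eq_one_of_rank_eq h)
    omega
  · rcases x.2 with hxl | hx1
    · exact throughStrands_le_of_mem_cellsAbove hxl
    · exact absurd (congrArg skeleton hx1) hx

theorem pow_eq_one_of_shape_eq_one (hx : shape x = 1) : x ^ m = 1 := Subtype.ext (pow_eq_one hx)

/-- Sandwiching between diagrams of lowest possible rank forgets the diagram in the middle, and
`m` is the exponent of the groups of loops. -/
theorem hom_eq_one {K : Type u} [Field K] (hm : (m : K) ≠ 0) (hl : l ≡ n [MOD 2]) (hln : l ≤ n)
    (f : cellSubmonoid (throughCell m n l) →* Multiplicative K) : f = 1 := by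
  have hn : 2 * (n / 2) ≤ n := by omega
  have eq_one_of_pow {a : Multiplicative K} (ha : a ^ m = 1) : a = 1 := by
    have hma : (m : K) * a.toAdd = 0 := by
      rw [← nsmul_eq_mul, ← toAdd_pow, ha, toAdd_one]
    exact toAdd_eq_zero.1 ((mul_eq_zero.1 hma).resolve_left hm)
  have eq_one_of_shape {x : cellSubmonoid (throughCell m n l)} (hx : shape x = tail (n / 2)) :
      f x = 1 := by
    have hpow : x ^ (m + 1) = x := Subtype.ext
      (pow_add_one_of_idempotent (show shape x * shape x = shape x by rw [hx, tail_mul_self hn]))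
    refine eq_one_of_pow (mul_eq_right (b := f x) |>.1 ?_)
    rw [← pow_succ, ← map_pow, hpow]
  obtain ⟨t, ht⟩ := exists_shape_eq (m := m) hl hln (a := tail (n / 2))
    (by
      rw [Nat.ModEq] at hl
      rw [rank_tail hn]
      omega)
  refine MonoidHom.ext fun x => ?_
  have htxt : f (t * x * t) = 1 := eq_one_of_shape (by
    rw [map_mul, map_mul, ht, tail_mul_mul_tail hn (by omega)])
  rwa [map_mul, map_mul, eq_one_of_shape ht, one_mul, mul_one] at htxt

end Shape

noncomputable instance : StarMul (TruncatedTL m n k l) :=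
  CellSubquotient.starMul (fun a (ha : throughStrands a = l) => (throughStrands_star a).trans ha)
    fun a (ha : throughStrands a + 2 = k) =>
      show throughStrands (star a) + 2 = k by rw [throughStrands_star, ha]

/-- The class of a diagram in the truncated monoid. -/
noncomputable def mk (k : ℕ) : cellSubmonoid (throughCell m n l) →* TruncatedTL m n k l :=
  (cellCon _ _).mk'

theorem mk_surjective : Function.Surjective (mk (m := m) (n := n) (l := l) k) := Con.mk'_surjective

section Mk

variable {x y : cellSubmonoid (throughCell m n l)}

theorem mk_eq_mk_of_mem (hx : x.1 ∈ cellsAbove {x : cyclicTL m n | throughStrands x + 2 = k})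
    (hy : y.1 ∈ cellsAbove {x : cyclicTL m n | throughStrands x + 2 = k}) : mk k x = mk k y :=
  (Con.eq _).2 (Or.inr ⟨hx, hy⟩)

theorem eq_or_rank_le_of_mk_eq_mk (h : mk k x = mk k y) :
    x = y ∨ rank (shape x) + 2 ≤ k ∧ rank (shape y) + 2 ≤ k := by
  have rank_le {z : cyclicTL m n}
      (hz : z ∈ cellsAbove {x : cyclicTL m n | throughStrands x + 2 = k}) :
      rank (skeleton z) + 2 ≤ k := by
    obtain ⟨a, rfl, hz⟩ := hz
    exact Nat.add_le_add_right (throughStrands_le_of_mem_cellsAbove ⟨a, rfl, hz⟩) 2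
  exact ((Con.eq _).1 h).imp_right fun h => ⟨rank_le h.1, rank_le h.2⟩

theorem isUnit_mk [NeZero m] (hkn : k ≤ n) : IsUnit (mk k x) ↔ shape x = 1 := by
  constructor
  · intro hx
    obtain ⟨s, hs⟩ := hx.exists_right_inv
    obtain ⟨y, rfl⟩ := mk_surjective s
    rw [← map_mul, ← map_one (mk k)] at hs
    have hxy : rank (shape (x * y)) = n := by
      rcases eq_or_rank_le_of_mk_eq_mk hs with hxy | ⟨-, h⟩
      · rw [hxy, map_one, rank_one]
      · rw [map_one, rank_one] at h
        omega
    rw [map_mul] at hxy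
    exact eq_one_of_rank_eq ((rank_le _).antisymm (hxy.ge.trans (rank_mul_le_left _ _)))
  · intro hx
    refine IsUnit.of_pow_eq_one (n := m) ?_ (NeZero.ne m)
    rw [← map_pow, pow_eq_one_of_shape_eq_one hx, map_one]

theorem pow_eq_one_of_isUnit [NeZero m] (hkn : k ≤ n) {s : TruncatedTL m n k l} (hs : IsUnit s) :
    s ^ m = 1 := by
  obtain ⟨x, rfl⟩ := mk_surjective s
  rw [← map_pow, pow_eq_one_of_shape_eq_one ((isUnit_mk hkn).1 hs), map_one]

theorem mk_mem_nonunits [NeZero m] (hkn : k ≤ n) (hl : l ≡ n [MOD 2]) (hln : l ≤ n) :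
    mk k x ∈ nonunits (TruncatedTL m n k l) ↔ shape x ∈ rankIdeal n (minCups n l) := by
  rw [mem_nonunits_iff, isUnit_mk hkn]
  refine ⟨(shape_eq_one_or_mem_rankIdeal hl hln x).resolve_left, fun hx h => ?_⟩
  rw [h, mem_rankIdeal_minCups hl hln, rank_one] at hx
  omega

theorem nonunits_eq [NeZero m] (hkn : k ≤ n) (hl : l ≡ n [MOD 2]) (hln : l ≤ n) :
    nonunits (TruncatedTL m n k l) = mk k '' (shape ⁻¹' rankIdeal n (minCups n l)) := by
  ext s
  obtain ⟨x, rfl⟩ := mk_surjective s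
  refine ⟨fun hx => ⟨x, (mk_mem_nonunits hkn hl hln).1 hx, rfl⟩, ?_⟩
  rintro ⟨y, hy, hyx⟩
  rw [← hyx]
  exact (mk_mem_nonunits hkn hl hln).2 hy

end Mk

section Connectedness

variable [NeZero m]

theorem nontrivial_nonunits (hl : l ≡ n [MOD 2]) (hkl : k < l) (hln : l ≤ n)
    (hc : 2 * (minCups n l + 1) ≤ n) : (nonunits (TruncatedTL m n k l)).Nontrivial := by
  have mem_ideal {d : ℕ} (hd : minCups n l ≤ d) (hdn : 2 * d ≤ n) :
      (tail d : JonesMonoid n) ∈ rankIdeal n (minCups n l) := by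
    rw [rankIdeal, Set.mem_ofPred_eq, rank_tail hdn]
    omega
  have hx := mem_ideal le_rfl (by omega)
  have hy := mem_ideal (Nat.le_succ _) hc
  obtain ⟨x, hxt⟩ := exists_shape_eq (m := m) hl hln ((mem_rankIdeal_minCups hl hln).1 hx).2
  obtain ⟨y, hyt⟩ := exists_shape_eq (m := m) hl hln ((mem_rankIdeal_minCups hl hln).1 hy).2
  refine ⟨mk k x, (mk_mem_nonunits (by omega) hl hln).2 (hxt ▸ hx),
    mk k y, (mk_mem_nonunits (by omega) hl hln).2 (hyt ▸ hy), fun h => ?_⟩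
  have hrank_x : rank (shape x) = n - 2 * minCups n l := by rw [hxt, rank_tail (by omega)]
  have hrank_y : rank (shape y) = n - 2 * (minCups n l + 1) := by rw [hyt, rank_tail hc]
  rcases eq_or_rank_le_of_mk_eq_mk h with rfl | ⟨hxk, -⟩
  · omega
  · have : n - 2 * minCups n l = n - 2 ∨ n - 2 * minCups n l = l := by
      rw [Nat.ModEq] at hl
      rw [minCups]
      omega
    omega

theorem isNullConnected (hkn : k ≤ n) (hl : l ≡ n [MOD 2]) (hln : l ≤ n) :
    IsNullConnected (TruncatedTL m n k l) := by
  intro s hs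
  obtain ⟨x, rfl⟩ := mk_surjective s
  have hx := (mk_mem_nonunits hkn hl hln).1 hs
  obtain ⟨p, q, hpq⟩ := exists_eq_mul_tail_mul hx
  have hc : 2 * minCups n l ≤ n := le_of_add_le_right hx
  have hp : p * tail (minCups n l) ∈ rankIdeal n (minCups n l) :=
    mul_mem_rankIdeal_right p (tail_mem_rankIdeal hc)
  have hq : tail (minCups n l) * q ∈ rankIdeal n (minCups n l) :=
    mul_mem_rankIdeal_left (tail_mem_rankIdeal hc) q
  obtain ⟨z, hz⟩ := exists_shape_eq (m := m) hl hln ((mem_rankIdeal_minCups hl hln).1 hq).2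
  obtain ⟨y, hy, rfl⟩ := exists_eq_mul_of_shape_eq (x := x) (y := z) hl hln
    ((mem_rankIdeal_minCups hl hln).1 hp).2
    (by rw [hpq, hz, ← mul_assoc, mul_assoc p (tail _) (tail _), tail_mul_self hc])
  exact ⟨mk k y, mk k z, (mk_mem_nonunits hkn hl hln).2 (hy ▸ hp),
    (mk_mem_nonunits hkn hl hln).2 (hz ▸ hq), map_mul _ _ _⟩

theorem exists_zero (hk : k ≡ n [MOD 2]) (hl : l ≡ n [MOD 2]) (hkl : k < l) (hln : l ≤ n)
    (hk2 : 2 ≤ k) : ∃ z ∈ nonunits (TruncatedTL m n k l), ∀ s, z * s = z := by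
  have hd : k + 2 * ((n - k + 2) / 2) = n + 2 := by
    rw [Nat.ModEq] at hk
    omega
  have hrank : rank (tail ((n - k + 2) / 2) : JonesMonoid n) + 2 = k := by
    rw [rank_tail (by omega)]
    omega
  obtain ⟨z, hz⟩ := exists_shape_eq (m := m) hl hln (a := tail ((n - k + 2) / 2)) (by omega)
  have hzk : z.1 ∈ cellsAbove {x : cyclicTL m n | throughStrands x + 2 = k} :=
    ⟨z.1, show rank (shape z) + 2 = k by rw [hz, hrank], 1, 1, by rw [one_mul, mul_one]⟩
  refine ⟨mk k z, ?_, fun s => ?_⟩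
  · rw [mk_mem_nonunits (by omega) hl hln, mem_rankIdeal_minCups hl hln, hz]
    omega
  · obtain ⟨x, rfl⟩ := mk_surjective s
    rw [← map_mul]
    exact mk_eq_mk_of_mem (cellsAbove_mul_right _ hzk) hzk

theorem isLeftConnectedSet_nonunits (hk : k ≡ n [MOD 2]) (hl : l ≡ n [MOD 2]) (hkl : k < l)
    (hln : l ≤ n) (hc : 2 ≤ k ∨ 3 + 2 * minCups n l ≤ n) :
    IsLeftConnectedSet (nonunits (TruncatedTL m n k l)) := by
  rcases hc with hk2 | hc
  · obtain ⟨z, hz, hzs⟩ := exists_zero (m := m) hk hl hkl hln hk2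
    exact isLeftConnectedSet_of_left_zero hz fun s _ => hzs s
  have hle {a : JonesMonoid n} (ha : a ∈ rankIdeal n (minCups n l)) : rank a ≤ l :=
    ((mem_rankIdeal_minCups hl hln).1 ha).2
  rw [nonunits_eq (by omega) hl hln]
  exact ((isLeftConnectedSet_rankIdeal hc).preimage (fun a ha b _ => mul_mem_rankIdeal_right b ha)
    (fun a ha => exists_shape_eq hl hln (hle ha))
    fun a ha x y h => exists_eq_mul_of_shape_eq hl hln (hle ha) h).image (mk k)

theorem isWellConnected (hk : k ≡ n [MOD 2]) (hl : l ≡ n [MOD 2]) (hkl : k < l) (hln : l ≤ n)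
    (hne : (nonunits (TruncatedTL m n k l)).Nonempty) (hc : 2 ≤ k ∨ 3 + 2 * minCups n l ≤ n) :
    IsWellConnected (TruncatedTL m n k l) :=
  have hleft := isLeftConnected_iff.2 ⟨hne, isLeftConnectedSet_nonunits hk hl hkl hln hc⟩
  ⟨isNullConnected (by omega) hl hln, hleft, hleft.isRightConnected⟩

end Connectedness

end TruncatedTL

theorem propositionP {K : Type u} [Field K] (m n k l : ℕ) [NeZero m]
    (hk : k ≡ n [MOD 2]) (hl : l ≡ n [MOD 2]) (hkl : k < l) (hln : l ≤ n) (hl3 : 3 ≤ l)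
    (hedge : l = n → 2 ≤ k ∨ 5 ≤ n) (hchar : ¬ ringChar K ∣ m) :
    (IsNullConnected (TruncatedTL m n k l) ∧ IsLeftConnected (TruncatedTL m n k l) ∧
      IsRightConnected (TruncatedTL m n k l)) ∧
    (∀ f : TruncatedTL m n k l →* Multiplicative K, f = 1) ∧
    ∃ g : ℕ, IsRepresentationGap K (TruncatedTL m n k l) g ∧
      IsLeast (nontrivialSimpleDims K (TruncatedTL m n k l)) g := by
  have hm : (m : K) ≠ 0 := mt (ringChar.spec K m).1 hchar
  have hcups : 2 * (TruncatedTL.minCups n l + 1) ≤ n ∧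
      (2 ≤ k ∨ 3 + 2 * TruncatedTL.minCups n l ≤ n) := by
    rw [Nat.ModEq] at hk hl
    rw [TruncatedTL.minCups]
    omega
  have hne := TruncatedTL.nontrivial_nonunits (m := m) hl hkl hln hcups.1
  have hwell := TruncatedTL.isWellConnected hk hl hkl hln hne.nonempty hcups.2
  have hhom (f : TruncatedTL m n k l →* Multiplicative K) : f = 1 :=
    (MonoidHom.cancel_right TruncatedTL.mk_surjective).1
      (TruncatedTL.hom_eq_one hm hl hln (f.comp (TruncatedTL.mk k)))
  have hpow (a : (TruncatedTL m n k l)ˣ) : a ^ m = 1 :=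
    Units.ext (TruncatedTL.pow_eq_one_of_isUnit (by omega) a.isUnit)
  exact ⟨⟨hwell.null, hwell.left, hwell.right⟩, hhom,
    exists_isRepresentationGap hm hpow hwell hhom hne⟩
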